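/- There are absolute constants $\bar\varepsilon>0$ and $c>0$ such that the following holds. **Setting.** Let $n,b\ge 1$, $d\ge 0$ and $T\ge 0$ be integers with $T\le c\,n^2/b^2$ (for instance $T=\lfloor cn^2/b^2\rfloor$). Let $0<\varepsilon\le\bar\varepsilon$ and $\delta\in(0,1)$ with $\varepsilon^2\le\log(1/\delta)$ (if $\bar\varepsilon^2\le\log 2$, this is automatic for $\delta\le 1/2$). Let $\mathcal Z$ be a set, $\mathcal X\subseteq\mathbb R^d$ closed and convex, $x^0\in\mathcal X$, $\alpha>0$, and $F:\mathcal X\times\mathcal Z\to\mathbb R$ convex in its first argument. For a positive definite matrix $A$ let $\|x\|_A=\sqrt{x^\top Ax}$ and let $\pi_A$ be the Euclidean projection onto the ellipsoid $\{x:\|x\|_A\le 1\}$. **Algorithms.** On a dataset $\mathcal S=(z_1,\dots,z_n)\in\mathcal Z^n$, both algorithms perform, for $k=0,\dots,T-1$, the following steps. 1. Draw $z^k_1,\dots,z^k_b$ from $\mathcal S$ uniformly with replacement, independently of the past. 2. Choose a positive definite matrix $A_k$ as a measurable function of $\hat g^0,\dots,\hat g^{k-1}$. The choice may be arbitrary but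 may not otherwise depend on $\mathcal S$. 3. Set $$\hat g^k=\frac1b\sum_{i=1}^b\pi_{A_k}(g^{k,i})+\frac{\sqrt{\log(1/\delta)}}{b\,\varepsilon}\,\xi^k ,\qquad g^{k,i}\in\partial F(x^k;z^k_i),$$ where, conditionally on the past and on the batch, $\xi^k\sim N(0,A_k^{-1})$. The subgradient $g^{k,i}$ is given by a rule that is measurable in $x^k$ and depends only on $k$, $i$, $x^k$ and $z^k_i$. 4. Update the point. * PASAN: $x^{k+1}$ is the Euclidean projection onto $\mathcal X$ of $x^k-\alpha_k\hat g^k$, where $\alpha_k=\alpha\big/\sqrt{\sum_{i=0}^k\|\hat g^i\|_2^2}$. * PAGAN: $x^{k+1}$ is the projection onto $\mathcal X$, with respect to $\|\cdot\|_{H_k}$, of $x^k-H_k^{-1}\hat g^k$, where $H_k=\frac1\alpha\,\mathrm{diag}\big(\sum_{i=0}^k\hat g^i(\hat g^i)^\top\big)^{1/2}$. Both return $\bar x^T=\frac1T\sum_{k=1}^Tx^k$. **Claim.** PASAN and PAGAN are both $(\varepsilon,\delta)$-differentially private: if $\mathcal S,\mathcal S'\in\mathcal Z^n$ differ in at most one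 entry and $O\subseteq\mathbb R^d$ is Borel, then $$\mathbb P\big(\bar x^T(\mathcal S)\in O\big)\le e^{\varepsilon}\,\mathbb P\big(\bar x^T(\mathcal S')\in O\big)+\delta .$$ -/

import Mathlib

open MeasureTheory ProbabilityTheory
open scoped MatrixOrder

namespace PrivateAdaptive

noncomputable section

/-- The parameter space `ℝ^d` with its Euclidean norm. -/
abbrev Vec (d : ℕ) := EuclideanSpace ℝ (Fin d)

/-! ### Differential privacy -/

/-- Two datasets of size `n` are neighbouring if they differ in at most one entry. -/
def Neighboring {n : ℕ} {Z : Type*} (S S' : Fin n → Z) : Prop :=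
  ∃ j : Fin n, ∀ i : Fin n, i ≠ j → S i = S' i

/-- A randomized algorithm on datasets of size `n`, given as a function `M` of the dataset and of
the internal randomness `ω`, which is distributed according to `μ`, is
`(ε, δ)`-differentially private. -/
def IsDP {Ω W Z : Type*} [MeasurableSpace Ω] [MeasurableSpace W] {n : ℕ} (μ : Measure Ω)
    (M : (Fin n → Z) → Ω → W) (ε δ : ℝ) : Prop :=
  ∀ S S' : Fin n → Z, Neighboring S S' → ∀ O : Set W, MeasurableSet O →
    μ {ω | M S ω ∈ O} ≤ ENNReal.ofReal (Real.exp ε) * μ {ω | M S' ω ∈ O} + ENNReal.ofReal δ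

/-! ### Norms, projections and subgradients -/

/-- The Mahalanobis norm `‖x‖_A = √(xᵀ A x)`. -/
def mahalanobis {d : ℕ} (A : Matrix (Fin d) (Fin d) ℝ) (x : Vec d) : ℝ :=
  √(x.ofLp ⬝ᵥ A.mulVec x.ofLp)

/-- The ellipsoid `E_A = {x | ‖x‖_A ≤ 1}`. -/
def ellipsoid {d : ℕ} (A : Matrix (Fin d) (Fin d) ℝ) : Set (Vec d) :=
  {x | mahalanobis A x ≤ 1}

/-- A minimizer of `φ` over `C`. It is used only for distances to closed convex nonempty sets `C`,
where the minimizer exists and is unique. -/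
def argminOn {d : ℕ} (C : Set (Vec d)) (φ : Vec d → ℝ) : Vec d :=
  Classical.epsilon fun y => y ∈ C ∧ ∀ y' ∈ C, φ y ≤ φ y'

/-- Projection onto `C` with respect to the Euclidean norm. -/
def proj {d : ℕ} (C : Set (Vec d)) (v : Vec d) : Vec d :=
  argminOn C fun y => ‖y - v‖

/-- Projection onto `C` with respect to the Mahalanobis norm `‖·‖_H`. -/
def projWrt {d : ℕ} (H : Matrix (Fin d) (Fin d) ℝ) (C : Set (Vec d)) (v : Vec d) : Vec d :=
  argminOn C fun y => mahalanobis H (y - v)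

/-- The subdifferential at `x` of a function on the domain `X`. -/
def subdifferential {d : ℕ} (X : Set (Vec d)) (f : Vec d → ℝ) (x : Vec d) : Set (Vec d) :=
  {v | ∀ y ∈ X, f x + inner ℝ v (y - x) ≤ f y}

/-! ### Randomness of one iteration

One iteration draws a batch of `b` indices, uniformly with replacement from `Fin n`, and an
independent standard normal vector, from which noise with a prescribed covariance is formed. -/

/-- The random draws of one iteration: the batch indices and a standard normal vector. -/
abbrev Draw (n b d : ℕ) := (Fin b → Fin n) × Vec d

/-- The law of the random draws of one iteration. -/
def drawLaw (n b d : ℕ) : Measure (Draw n b d) :=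
  (uniformOn (Set.univ : Set (Fin b → Fin n))).prod (stdGaussian (Vec d))

/-- The law of the internal randomness of `T` iterations: the draws are i.i.d. -/
def runLaw (n b d T : ℕ) : Measure (Fin T → Draw n b d) :=
  Measure.pi fun _ => drawLaw n b d

/-- The image `Σ^{1/2} w` of `w` under the symmetric square root of `Σ`. -/
def colour {d : ℕ} (Sig : Matrix (Fin d) (Fin d) ℝ) (w : Vec d) : Vec d :=
  Matrix.toEuclideanCLM (𝕜 := ℝ) (CFC.sqrt Sig) w

/-- If `w` is standard normal, then `colour Σ w` has the law `N(0, Σ)`. -/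
theorem map_colour_stdGaussian {d : ℕ} (Sig : Matrix (Fin d) (Fin d) ℝ) :
    (stdGaussian (Vec d)).map (colour Sig) = multivariateGaussian 0 Sig := by
  simp only [multivariateGaussian, zero_add]
  rfl

/-! ### The private gradients

The history before iteration `k` is the sequence `ĝ^0, …, ĝ^{k-1}` of the private gradients
computed so far. The iterate `x^k` and the ellipsoid matrix `A_k` are functions of it. -/

/-- The private gradient of iteration `k`,
`ĝ^k = (1/b) ∑_i π_{A_k}(g^{k,i}) + (√(log (1/δ)) / (b ε)) ξ^k` with `ξ^k ∼ N(0, A_k⁻¹)`, as a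
function of the dataset `S`, the current point `x`, the matrix `A`, and the draws `ω` of this
iteration. Here `g i x z` is the subgradient of `F(·; z)` at `x` which the algorithm uses for the
`i`-th element of the batch. -/
def privateGradient {n b d : ℕ} {Z : Type*} (ε δ : ℝ) (g : Fin b → Vec d → Z → Vec d)
    (S : Fin n → Z) (x : Vec d) (A : Matrix (Fin d) (Fin d) ℝ) (ω : Draw n b d) : Vec d :=
  (1 / (b : ℝ)) • ∑ i : Fin b, proj (ellipsoid A) (g i x (S (ω.1 i))) +
    (√(Real.log (1 / δ)) / ((b : ℝ) * ε)) • colour A⁻¹ ω.2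

/-- The private gradients `ĝ^0, …, ĝ^{k-1}` of the first `k` iterations, as a function of the draws
of these iterations. `iter k h` and `A k h` are the point `x^k` and the matrix `A_k` after the
history `h`. -/
def history {n b d : ℕ} {Z : Type*} (ε δ : ℝ) (g : ℕ → Fin b → Vec d → Z → Vec d)
    (A : (k : ℕ) → (Fin k → Vec d) → Matrix (Fin d) (Fin d) ℝ)
    (iter : (k : ℕ) → (Fin k → Vec d) → Vec d) (S : Fin n → Z) :
    (k : ℕ) → (Fin k → Draw n b d) → (Fin k → Vec d)
  | 0, _ => Fin.elim0
  | k + 1, ω =>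
    let h := history ε δ g A iter S k (Fin.init ω)
    Fin.snoc h (privateGradient ε δ (g k) S (iter k h) (A k h) (ω (Fin.last k)))

/-- The average `(1/T) ∑_{k=1}^T x^k` of the iterates after the history `ĝ^0, …, ĝ^{T-1}`. -/
def averageIterate {d : ℕ} (iter : (k : ℕ) → (Fin k → Vec d) → Vec d) (T : ℕ)
    (h : Fin T → Vec d) : Vec d :=
  (1 / (T : ℝ)) • ∑ k : Fin T, iter (k + 1) fun i => h (Fin.castLE k.isLt i)

/-! ### The two algorithms -/

/-- The iterate `x^k` of PASAN as a function of `ĝ^0, …, ĝ^{k-1}`: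
`x^{k+1} = Π_X (x^k - α_k ĝ^k)` with `α_k = α / √(∑_{i ≤ k} ‖ĝ^i‖²)`. -/
def pasanIter {d : ℕ} (X : Set (Vec d)) (x₀ : Vec d) (α : ℝ) :
    (k : ℕ) → (Fin k → Vec d) → Vec d
  | 0, _ => x₀
  | k + 1, h =>
    proj X (pasanIter X x₀ α k (Fin.init h) - (α / √(∑ i, ‖h i‖ ^ 2)) • h (Fin.last k))

/-- The preconditioner `diag(∑_i ĝ^i (ĝ^i)ᵀ)^{1/2} / α` of PAGAN. -/
def adagradMatrix {d m : ℕ} (α : ℝ) (h : Fin m → Vec d) : Matrix (Fin d) (Fin d) ℝ :=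
  (1 / α) • Matrix.diagonal fun j => √(∑ i, h i j ^ 2)

open Classical in
/-- The iterate `x^k` of PAGAN as a function of `ĝ^0, …, ĝ^{k-1}`: `x^{k+1}` is the projection of
`x^k - H_k⁻¹ ĝ^k` onto `X` with respect to `‖·‖_{H_k}`. In the null event that `H_k` is singular,
where this formula is meaningless, the point is left unchanged. -/
def paganIter {d : ℕ} (X : Set (Vec d)) (x₀ : Vec d) (α : ℝ) :
    (k : ℕ) → (Fin k → Vec d) → Vec d
  | 0, _ => x₀
  | k + 1, h =>
    let x := paganIter X x₀ α k (Fin.init h)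
    let H := adagradMatrix α h
    if H.PosDef then
      projWrt H X (x - Matrix.toEuclideanCLM (𝕜 := ℝ) H⁻¹ (h (Fin.last k)))
    else x

/-- The output of PASAN on the dataset `S` with batch size `b` and `T` iterations, as a function of
the internal randomness. -/
def pasan {n b d : ℕ} {Z : Type*} (X : Set (Vec d)) (x₀ : Vec d) (α ε δ : ℝ)
    (g : ℕ → Fin b → Vec d → Z → Vec d)
    (A : (k : ℕ) → (Fin k → Vec d) → Matrix (Fin d) (Fin d) ℝ) (T : ℕ)
    (S : Fin n → Z) (ω : Fin T → Draw n b d) : Vec d :=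
  averageIterate (pasanIter X x₀ α) T (history ε δ g A (pasanIter X x₀ α) S T ω)

/-- The output of PAGAN on the dataset `S` with batch size `b` and `T` iterations, as a function of
the internal randomness. -/
def pagan {n b d : ℕ} {Z : Type*} (X : Set (Vec d)) (x₀ : Vec d) (α ε δ : ℝ)
    (g : ℕ → Fin b → Vec d → Z → Vec d)
    (A : (k : ℕ) → (Fin k → Vec d) → Matrix (Fin d) (Fin d) ℝ) (T : ℕ)
    (S : Fin n → Z) (ω : Fin T → Draw n b d) : Vec d :=
  averageIterate (paganIter X x₀ α) T (history ε δ g A (paganIter X x₀ α) S T ω)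

end

end PrivateAdaptive

namespace PrivateAdaptive

noncomputable section

/-! Both outputs are measurable functions of the private gradients, and the point and the ellipsoid
of each step are functions of the earlier private gradients. By post-processing and adaptive
composition it is enough to compare a single step on two neighbouring datasets with the history
fixed, and to show that `T` such comparisons stay within the budget.

Put `s = √(log (1/δ)) / ε`, so `s ≥ 1`. After whitening by `A_k^{1/2}`, a step adds standard
Gaussian noise to vectors in a ball of radius `1/s`. To isolate the differing index `j`, draw every
batch position from the other indices and then overwrite it by `j` with probability `1/n`,
independently. Given the first draw, the two outputs are, up to a common translation, Gaussian
mixtures with the same weights, indexed by the set of overwritten positions. A component with `k`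
overwritten positions has shift at most `2k/s`, and its weight is geometrically small in `k`, with
small parameter `σ² = 2b/n`.

Relative to the unshifted Gaussian both densities have mean one and deviate from 1 by order `σ²/s`
in mean square. The first-order terms therefore cancel in the moment defining the Rényi divergence
of order `1 + λ`, and its logarithm is of order `(λσ²/s)²`, that is `λ²(b/n)²/s²`, independently of
the dimension. Over `T ≤ c n²/b²` steps this adds up to a small multiple of `λ²/s²`. With `λ = 1000
s²ε` the sum is at most `λε/2`, and what remains is a failure probability `exp(-λε/2) = δ^500`.

Since `λ` is large, rare large values of the likelihood ratio could dominate this moment. They are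
removed by `cutExp`, after which both densities are within `σ` of 1. This costs `τ = σ⁴ exp(-s²)`
per step, in total a small multiple of `exp(-s²) ≤ δ`.

The main lemmas are `integral_exp_le` (moment bound), `sum_lintegral_le_rpow` (its Hölder form for
mixtures), `isHoelderClose_noisyMean` (one step), `IsHoelderClose.prod` (composition) and
`IsHoelderClose.measure_le` (conversion to privacy). When `δ` is close to 1 the same analysis is run
at the level `1/10`, and the excess is absorbed into `δ`. -/

/-! ### Shifts and exponential moments of the standard Gaussian measure. -/

theorem gaussianReal_map_add_eq_withDensity (u : ℝ) :
    (gaussianReal 0 1).map (· + u) =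
      (gaussianReal 0 1).withDensity fun x => ENNReal.ofReal (Real.exp (x * u - u ^ 2 / 2)) := by
  rw [gaussianReal_map_add_const, gaussianReal_of_var_ne_zero _ one_ne_zero,
    gaussianReal_of_var_ne_zero _ one_ne_zero,
    ← withDensity_mul _ (measurable_gaussianPDF _ _) (by fun_prop)]
  congr 1
  ext x
  simp only [gaussianPDF, Pi.mul_apply]
  rw [← ENNReal.ofReal_mul (gaussianPDFReal_nonneg _ _ _)]
  congr 1
  simp only [gaussianPDFReal, mul_assoc, ← Real.exp_add]
  congr 3
  simp
  ring

theorem pi_withDensity_eq {d : ℕ} (μ : Fin d → Measure ℝ) [∀ i, IsProbabilityMeasure (μ i)]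
    (f : Fin d → ℝ → ENNReal) (hf : ∀ i, Measurable (f i))
    [∀ i, IsProbabilityMeasure ((μ i).withDensity (f i))] :
    Measure.pi (fun i => (μ i).withDensity (f i)) =
      (Measure.pi μ).withDensity fun x => ∏ i, f i (x i) := by
  refine Measure.pi_eq fun s hs => ?_
  rw [withDensity_apply _ (MeasurableSet.univ_pi hs), ← lintegral_indicator (MeasurableSet.univ_pi hs)]
  have : (Set.univ.pi s).indicator (fun x : Fin d → ℝ => ∏ i, f i (x i)) =
      fun x => ∏ i, (s i).indicator (f i) (x i) := by
    ext x
    by_cases hx : x ∈ Set.univ.pi s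
    · rw [Set.indicator_of_mem hx]
      exact Finset.prod_congr rfl fun i _ => (Set.indicator_of_mem (hx i trivial) _).symm
    · rw [Set.indicator_of_notMem hx]
      simp only [Set.mem_pi, Set.mem_univ, true_imp_iff, not_forall] at hx
      obtain ⟨i, hi⟩ := hx
      exact (Finset.prod_eq_zero (Finset.mem_univ i) (Set.indicator_of_notMem hi _)).symm
  rw [this]
  have hm : ∀ i, Measurable ((s i).indicator (f i)) := fun i => (hf i).indicator (hs i)
  have hind : iIndepFun (fun i (x : Fin d → ℝ) => (s i).indicator (f i) (x i)) (Measure.pi μ) :=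
    iIndepFun_pi fun i => (hm i).aemeasurable
  rw [lintegral_prod_eq_prod_lintegral_of_indepFun Finset.univ _ hind
    fun i => (hm i).comp (measurable_pi_apply i)]
  refine Finset.prod_congr rfl fun i _ => ?_
  rw [withDensity_apply _ (hs i), ← lintegral_indicator (hs i)]
  exact (measurePreserving_eval μ i).lintegral_comp (hm i)

/-- Cameron–Martin formula for the standard Gaussian measure. -/
theorem lintegral_stdGaussian_add {d : ℕ} (u : Vec d) {φ : Vec d → ENNReal} (hφ : Measurable φ) :
    ∫⁻ w, φ (w + u) ∂stdGaussian (Vec d) =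
      ∫⁻ w, ENNReal.ofReal (Real.exp (inner ℝ w u - ‖u‖ ^ 2 / 2)) * φ w ∂stdGaussian (Vec d) := by
  have hto : Measurable (WithLp.toLp 2 : (Fin d → ℝ) → Vec d) := by fun_prop
  rw [← map_pi_eq_stdGaussian, lintegral_map (by fun_prop) hto, lintegral_map (by fun_prop) hto]
  have hshift : ∫⁻ x, φ (WithLp.toLp 2 x + u) ∂(Measure.pi fun _ : Fin d => gaussianReal 0 1) =
      ∫⁻ x, φ (WithLp.toLp 2 x) ∂(Measure.pi fun _ : Fin d => gaussianReal 0 1).map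
        (fun x i => x i + u i) := by
    rw [lintegral_map (by fun_prop) (by fun_prop)]
    rfl
  have hpm : ∀ i, IsProbabilityMeasure ((gaussianReal 0 1).map (· + u i)) := fun i =>
    Measure.isProbabilityMeasure_map (by fun_prop)
  have hpd : ∀ i, IsProbabilityMeasure ((gaussianReal 0 1).withDensity
      fun x => ENNReal.ofReal (Real.exp (x * u i - u i ^ 2 / 2))) := fun i => by
    rw [← gaussianReal_map_add_eq_withDensity]; exact hpm i
  have hpi := Measure.pi_map_pi (μ := fun _ : Fin d => gaussianReal 0 1)
    (f := fun i x => x + u i) (fun i => by fun_prop)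
  simp_rw [gaussianReal_map_add_eq_withDensity] at hpi
  rw [hshift, hpi, pi_withDensity_eq _ _ (fun i => by fun_prop),
    lintegral_withDensity_eq_lintegral_mul _ (by fun_prop) (by fun_prop)]
  refine lintegral_congr fun x => ?_
  simp only [Pi.mul_apply]
  congr 1
  rw [← ENNReal.ofReal_prod_of_nonneg fun i _ => (Real.exp_pos _).le, ← Real.exp_sum]
  congr 2
  rw [Finset.sum_sub_distrib, EuclideanSpace.real_norm_sq_eq, Finset.sum_div]
  congr 1
  simp [PiLp.inner_apply, mul_comm]

theorem map_inner_stdGaussian {d : ℕ} (u : Vec d) :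
    (stdGaussian (Vec d)).map (fun w => inner ℝ w u) = gaussianReal 0 (‖u‖ ^ 2).toNNReal := by
  have h := IsGaussian.map_eq_gaussianReal (μ := stdGaussian (Vec d)) (innerSL ℝ u)
  rw [integral_strongDual_stdGaussian, variance_dual_stdGaussian, innerSL_apply_norm] at h
  rw [← h]
  congr 1
  ext w
  simp [real_inner_comm]

/-- The Cameron–Martin density has total mass one: take the test function 1 in
`lintegral_stdGaussian_add`. -/
theorem lintegral_exp_inner_stdGaussian {d : ℕ} (u : Vec d) :
    ∫⁻ w, ENNReal.ofReal (Real.exp (inner ℝ w u)) ∂stdGaussian (Vec d) =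
      ENNReal.ofReal (Real.exp (‖u‖ ^ 2 / 2)) := by
  have h := lintegral_stdGaussian_add u (φ := fun _ => 1) measurable_const
  simp only [lintegral_one, measure_univ, mul_one, sub_eq_add_neg, Real.exp_add] at h
  simp_rw [ENNReal.ofReal_mul (Real.exp_pos _).le] at h
  rw [lintegral_mul_const _ (by fun_prop)] at h
  have h2 := congrArg (· * ENNReal.ofReal (Real.exp (‖u‖ ^ 2 / 2))) h
  simp only [one_mul, mul_assoc] at h2
  rw [← ENNReal.ofReal_mul (Real.exp_pos _).le, ← Real.exp_add] at h2
  simpa using h2.symm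

/-- Scaling reduces to unit variance, where `exp (x²/4)` times the density of `N(0,1)` is `√2` times
the density of `N(0,2)`. -/
theorem lintegral_exp_sq_gaussianReal {v : NNReal} (hv : v ≤ 1) :
    ∫⁻ x, ENNReal.ofReal (Real.exp (x ^ 2 / 4)) ∂gaussianReal 0 v ≤ 2 := by
  have hmap : gaussianReal 0 v = (gaussianReal 0 1).map (√(v : ℝ) * ·) := by
    rw [gaussianReal_map_const_mul]
    congr 1
    · simp
    · ext
      simp
  rw [hmap, lintegral_map (by fun_prop) (by fun_prop), gaussianReal_of_var_ne_zero _ one_ne_zero,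
    lintegral_withDensity_eq_lintegral_mul _ (measurable_gaussianPDF _ _) (by fun_prop)]
  calc _ ≤ ∫⁻ x, ENNReal.ofReal √2 * gaussianPDF 0 2 x := by
        refine lintegral_mono fun x => ?_
        simp only [Pi.mul_apply, gaussianPDF]
        rw [← ENNReal.ofReal_mul (gaussianPDFReal_nonneg _ _ _),
          ← ENNReal.ofReal_mul (Real.sqrt_nonneg _)]
        refine ENNReal.ofReal_le_ofReal ?_
        have h1 : (√(v : ℝ) * x) ^ 2 / 4 ≤ x ^ 2 / 4 := by
          rw [mul_pow, Real.sq_sqrt v.coe_nonneg]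
          have : (v : ℝ) ≤ 1 := hv
          nlinarith [sq_nonneg x]
        have hpi : (0 : ℝ) < √(2 * Real.pi) := by positivity
        calc gaussianPDFReal 0 1 x * Real.exp ((√(v : ℝ) * x) ^ 2 / 4)
            ≤ gaussianPDFReal 0 1 x * Real.exp (x ^ 2 / 4) := by
              gcongr
              exact gaussianPDFReal_nonneg _ _ _
          _ = √2 * gaussianPDFReal 0 2 x := by
              simp only [gaussianPDFReal, NNReal.coe_one, NNReal.coe_ofNat, mul_one, sub_zero]
              rw [mul_assoc, ← Real.exp_add, mul_comm 2 Real.pi, mul_assoc,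
                mul_comm Real.pi (2 * 2), Real.sqrt_mul' _ zero_le_two,
                Real.sqrt_mul (by norm_num : (0 : ℝ) ≤ 2 * 2),
                Real.sqrt_mul_self zero_le_two]
              have h2 : √2 * √2 = 2 := Real.mul_self_sqrt zero_le_two
              have h3 : (√Real.pi) ≠ 0 := by positivity
              have h4 : √2 ≠ 0 := by positivity
              have h5 : -x ^ 2 / 2 + x ^ 2 / 4 = -x ^ 2 / (2 * 2) := by ring
              rw [h5, ← mul_assoc]
              congr 1
              field_simp
              linarith
    _ = ENNReal.ofReal √2 := by
        rw [lintegral_const_mul _ (measurable_gaussianPDF _ _),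
          lintegral_gaussianPDF_eq_one _ two_ne_zero, mul_one]
    _ ≤ ENNReal.ofReal 2 := ENNReal.ofReal_le_ofReal (Real.sqrt_le_iff.2 ⟨by norm_num, by norm_num⟩)
    _ = 2 := by simp

theorem lintegral_exp_inner_sq_le {d : ℕ} {u : Vec d} (hu : ‖u‖ ≤ 1) :
    ∫⁻ w, ENNReal.ofReal (Real.exp ((inner ℝ w u) ^ 2 / 4)) ∂stdGaussian (Vec d) ≤ 2 := by
  have h := lintegral_exp_sq_gaussianReal (v := (‖u‖ ^ 2).toNNReal)
    (by rw [Real.toNNReal_le_one]; exact pow_le_one₀ (norm_nonneg _) hu)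
  rwa [← map_inner_stdGaussian, lintegral_map (by fun_prop) (by fun_prop)] at h

/-! ### Scalar estimates for the exponential and for the truncated likelihood ratio. -/

theorem abs_exp_sub_one_le (x : ℝ) : |Real.exp x - 1| ≤ |x| * Real.exp (max x 0) := by
  rcases le_total 0 x with h | h
  · rw [max_eq_left h, abs_of_nonneg h, abs_of_nonneg (by linarith [Real.add_one_le_exp x])]
    have h1 := Real.add_one_le_exp (-x)
    have h2 : Real.exp x * Real.exp (-x) = 1 := by rw [← Real.exp_add]; simp
    nlinarith [Real.exp_pos x]
  · rw [max_eq_right h, abs_of_nonpos h, Real.exp_zero,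
      abs_of_nonpos (by linarith [Real.exp_le_one_iff.2 h])]
    linarith [Real.add_one_le_exp x]

/-- The linear term keeps its exact coefficient, so that after integration it nearly vanishes and
only the quadratic remainder counts. -/
theorem exp_le_one_add_add_sq_mul (y : ℝ) : Real.exp y ≤ 1 + y + y ^ 2 * Real.exp |y| := by
  rcases le_total 0 y with h | h
  · have h1 : Real.exp y - 1 ≤ y * Real.exp y := by
      have := abs_exp_sub_one_le y
      rw [max_eq_left h, abs_of_nonneg h] at this
      exact (le_abs_self _).trans this
    rw [abs_of_nonneg h]
    nlinarith [Real.exp_pos y]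
  · have h2 : 1 ≤ Real.exp |y| := Real.one_le_exp (abs_nonneg y)
    rcases le_total (-1) y with h1 | h1
    · have h3 := Real.abs_exp_sub_one_sub_id_le (x := y) (by rw [abs_le]; constructor <;> linarith)
      nlinarith [le_abs_self (Real.exp y - 1 - y), sq_nonneg y]
    · nlinarith [Real.exp_le_one_iff.2 h, sq_nonneg y]

/-- The likelihood ratio `exp (t - h)`, cut off where `exp t` exceeds `σ⁻ᵏ`. -/
def cutExp (σ : ℝ) (k : ℕ) (t h : ℝ) : ℝ :=
  if Real.exp t * σ ^ k ≤ 1 then Real.exp (t - h) else 0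

section CutExp

variable {σ : ℝ} {k : ℕ} {t h : ℝ}

theorem cutExp_nonneg : 0 ≤ cutExp σ k t h := by
  unfold cutExp
  split_ifs
  exacts [(Real.exp_pos _).le, le_rfl]

theorem cutExp_le : cutExp σ k t h ≤ Real.exp (t - h) := by
  unfold cutExp
  split_ifs
  exacts [le_rfl, (Real.exp_pos _).le]

/-- Where the ratio is cut to 0 its distance to 1 is exactly 1, which this lower bound on `t`
dominates by `|t|`. -/
theorem one_lt_of_exp_mul_pow (hσ : 0 < σ) (hσ1 : σ ≤ Real.exp (-1)) (hk : k ≠ 0)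
    (ht : ¬ Real.exp t * σ ^ k ≤ 1) : 1 < t := by
  by_contra! h
  refine ht ?_
  have h1 : σ ≤ 1 := hσ1.trans (by simp)
  calc Real.exp t * σ ^ k ≤ Real.exp 1 * σ := by
        gcongr
        exact pow_le_of_le_one hσ.le h1 hk
    _ ≤ Real.exp 1 * Real.exp (-1) := by gcongr
    _ = 1 := by rw [← Real.exp_add]; simp

theorem abs_cutExp_sub_one_le_exp (hσ : 0 < σ) (hσ1 : σ ≤ Real.exp (-1)) (hk : k ≠ 0)
    (hh : 0 ≤ h) : |cutExp σ k t h - 1| ≤ Real.exp |t| * (|t| + h) := by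
  unfold cutExp
  split_ifs with hc
  · refine (abs_exp_sub_one_le _).trans ?_
    rw [mul_comm]
    gcongr
    · exact max_le (by linarith [le_abs_self t]) (abs_nonneg t)
    · exact (abs_sub _ _).trans (by rw [abs_of_nonneg hh])
  · have := one_lt_of_exp_mul_pow hσ hσ1 hk hc
    have h2 : 1 ≤ Real.exp |t| := Real.one_le_exp (abs_nonneg t)
    have h3 := le_abs_self t
    simp only [zero_sub, abs_neg, abs_one]
    nlinarith

/-- One factor `σ ^ k` cancels the largest value the truncated ratio can take, so the bound is free
of exponentials. -/
theorem pow_mul_abs_cutExp_sub_one_le (hσ : 0 < σ) (hσ1 : σ ≤ Real.exp (-1)) (hk : k ≠ 0)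
    (hh : 0 ≤ h) : σ ^ k * |cutExp σ k t h - 1| ≤ |t| + h := by
  have h1 : σ ^ k ≤ 1 := pow_le_one₀ hσ.le (hσ1.trans (by simp))
  have h0 : 0 < σ ^ k := pow_pos hσ k
  unfold cutExp
  split_ifs with hc
  · have h2 : Real.exp (max (t - h) 0) * σ ^ k ≤ 1 := by
      rcases le_total (t - h) 0 with h' | h'
      · simpa [max_eq_right h'] using h1
      · rw [max_eq_left h']
        refine le_trans ?_ hc
        gcongr
        linarith
    calc _ ≤ σ ^ k * (|t - h| * Real.exp (max (t - h) 0)) := by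
          gcongr
          exact abs_exp_sub_one_le _
      _ = |t - h| * (Real.exp (max (t - h) 0) * σ ^ k) := by ring
      _ ≤ |t - h| * 1 := by gcongr
      _ ≤ _ := by
        rw [mul_one]
        exact (abs_sub _ _).trans (by rw [abs_of_nonneg hh])
  · have := one_lt_of_exp_mul_pow hσ hσ1 hk hc
    have h3 := le_abs_self t
    simp only [zero_sub, abs_neg, abs_one]
    linarith

theorem pow_mul_abs_cutExp_sub_one_le_one (hσ : 0 < σ) (hσ1 : σ ≤ 1)
    (hh : 0 ≤ h) : σ ^ k * |cutExp σ k t h - 1| ≤ 1 := by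
  have h1 : σ ^ k ≤ 1 := pow_le_one₀ hσ.le hσ1
  have h0 : 0 < σ ^ k := pow_pos hσ k
  have h2 : σ ^ k * cutExp σ k t h ≤ 1 := by
    unfold cutExp
    split_ifs with hc
    · refine le_trans ?_ hc
      rw [mul_comm]
      gcongr
      linarith
    · simp
  have h3 : 0 ≤ σ ^ k * cutExp σ k t h := mul_nonneg h0.le cutExp_nonneg
  have h4 : σ ^ k * |cutExp σ k t h - 1| = |σ ^ k * (cutExp σ k t h - 1)| := by
    rw [abs_mul, abs_of_pos h0]
  rw [h4, abs_le]
  constructor <;> linarith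

/-- Passing from `k` to `k + 1` multiplies the left side by at most `(9/4) σ < 1`, so the maximum is
at `k = 2`. -/
theorem sq_mul_pow_le {k : ℕ} (hk : 2 ≤ k) (hσ : 0 ≤ σ) (hσ1 : σ ≤ 1 / 4) :
    (k : ℝ) ^ 2 * σ ^ k ≤ 4 * σ ^ 2 := by
  induction k, hk using Nat.le_induction with
  | base => norm_num
  | succ k hk ih =>
    refine le_trans ?_ ih
    have h2 : (2 : ℝ) ≤ k := by exact_mod_cast hk
    have h3 : ((k + 1 : ℕ) : ℝ) ^ 2 * σ ≤ (k : ℝ) ^ 2 := by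
      push_cast
      nlinarith
    calc _ = (((k + 1 : ℕ) : ℝ) ^ 2 * σ) * σ ^ k := by ring
      _ ≤ _ := by gcongr

variable {η z : ℝ}

/-- Here `z` is the shift direction's inner product, normalised to have variance at most one. The
first bound is proportional to `σ²η` but exponential in `|z|`; the second is only quadratic in `z`
and may therefore stand in an exponent. For `k ≥ 2` one of the two factors `σ ^ k` is spare and
absorbs `k²`; only `k = 1` needs the extra terms. -/
theorem pow_mul_abs_cutExp_le_mul_exp (hσ : 0 < σ) (hσ1 : σ ≤ 1 / 4) (hk : k ≠ 0) (hη : 0 ≤ η)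
    (hη2 : η ≤ 2) (hh : 0 ≤ h) (hhk : h ≤ (η * k) ^ 2 / 2) :
    (σ ^ 2) ^ k * |cutExp σ k (η * k * z) h - 1| ≤
      4 * σ ^ 2 * η * (|z| + 1) * Real.exp (2 * |z|) ∧
    (σ ^ 2) ^ k * |cutExp σ k (η * k * z) h - 1| ≤
      4 * σ ^ 2 * η * (|z| + 1) + σ * η ^ 2 * z ^ 2 := by
  have hσe : σ ≤ Real.exp (-1) := by
    refine hσ1.trans ?_
    rw [Real.exp_neg, one_div]
    exact inv_anti₀ (Real.exp_pos 1) (by linarith [Real.exp_one_lt_d9])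
  have hz := abs_nonneg z
  have hsq : (σ ^ 2) ^ k = σ ^ k * σ ^ k := by rw [← pow_mul, mul_comm, ← pow_add]; ring_nf
  have habs : |η * k * z| = η * k * |z| := by
    rw [abs_mul, abs_of_nonneg (by positivity)]
  rcases Nat.lt_or_ge k 2 with hk2 | hk2
  · obtain rfl : k = 1 := by omega
    simp only [Nat.cast_one, mul_one, pow_one] at *
    have hh' : h ≤ η := by nlinarith
    have hexp1 : Real.exp |η * z| ≤ Real.exp (2 * |z|) := by
      rw [habs]; gcongr
    have hb := abs_cutExp_sub_one_le_exp (t := η * z) hσ hσe one_ne_zero hh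
    have hle : |η * z| + h ≤ η * (|z| + 1) := by rw [habs]; linarith
    have hp : 0 ≤ σ ^ 2 * (η * (|z| + 1)) := by positivity
    constructor
    · calc _ ≤ σ ^ 2 * (Real.exp (2 * |z|) * (η * (|z| + 1))) := by
            refine mul_le_mul_of_nonneg_left ?_ (sq_nonneg σ)
            exact hb.trans (mul_le_mul hexp1 hle (by positivity) (by positivity))
        _ = (σ ^ 2 * (η * (|z| + 1))) * Real.exp (2 * |z|) := by ring
        _ ≤ (4 * (σ ^ 2 * (η * (|z| + 1)))) * Real.exp (2 * |z|) :=
            mul_le_mul_of_nonneg_right (by linarith) (Real.exp_pos _).le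
        _ = _ := by ring
    · rcases le_total |η * z| 1 with h1 | h1
      · calc _ ≤ σ ^ 2 * (4 * (η * (|z| + 1))) := by
              gcongr
              refine hb.trans ?_
              gcongr
              exact (Real.exp_le_exp.2 h1).trans (by linarith [Real.exp_one_lt_d9])
          _ ≤ _ := by nlinarith [mul_nonneg hσ.le (sq_nonneg (η * z))]
      -- Here `|ηz| ≥ 1`: one factor `σ` bounds the cut ratio by 1, and this 1 is replaced by
      -- `(ηz)²`.
      · have h2 := pow_mul_abs_cutExp_sub_one_le_one (k := 1) (t := η * z) hσ (by linarith) hh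
        rw [pow_one] at h2
        have h3 : 1 ≤ (η * z) ^ 2 := by rw [← sq_abs]; nlinarith
        calc _ = σ * (σ * |cutExp σ 1 (η * z) h - 1|) := by ring
          _ ≤ σ * (η * z) ^ 2 := by gcongr; linarith
          _ ≤ _ := by nlinarith
  · have hb := pow_mul_abs_cutExp_sub_one_le (t := η * k * z) hσ hσe hk hh
    have hk1 : (1 : ℝ) ≤ k := by exact_mod_cast (by omega : 1 ≤ k)
    have hle : |η * k * z| + h ≤ k ^ 2 * (η * (|z| + 1)) := by
      rw [habs]
      have h1 : η * k * |z| ≤ k ^ 2 * (η * |z|) := by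
        have : 0 ≤ η * |z| := by positivity
        nlinarith [mul_nonneg this (by nlinarith : (0 : ℝ) ≤ (k : ℝ) ^ 2 - k)]
      have h2 : h ≤ k ^ 2 * η := by nlinarith [mul_nonneg (sq_nonneg (k : ℝ)) hη]
      linarith
    have hmain : (σ ^ 2) ^ k * |cutExp σ k (η * k * z) h - 1| ≤ 4 * σ ^ 2 * η * (|z| + 1) := by
      calc _ = σ ^ k * (σ ^ k * |cutExp σ k (η * k * z) h - 1|) := by rw [hsq]; ring
        _ ≤ σ ^ k * (k ^ 2 * (η * (|z| + 1))) :=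
          mul_le_mul_of_nonneg_left (hb.trans hle) (by positivity)
        _ = (k ^ 2 * σ ^ k) * (η * (|z| + 1)) := by ring
        _ ≤ (4 * σ ^ 2) * (η * (|z| + 1)) := by
          gcongr ?_ * _
          exact sq_mul_pow_le hk2 hσ.le hσ1
        _ = _ := by ring
    constructor
    · refine hmain.trans (le_mul_of_one_le_right (by positivity) ?_)
      exact Real.one_le_exp (by positivity)
    · refine hmain.trans (le_add_of_nonneg_right (by positivity))

end CutExp

/-- The function `x² exp x`, which controls the second-order term of the exponential. -/
def sqExp (x : ℝ) : ℝ := x ^ 2 * Real.exp x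

theorem sqExp_mono {x y : ℝ} (hx : 0 ≤ x) (h : x ≤ y) : sqExp x ≤ sqExp y := by
  unfold sqExp
  gcongr

theorem sqExp_nonneg (x : ℝ) : 0 ≤ sqExp x := by unfold sqExp; positivity

theorem convexOn_sqExp : ConvexOn ℝ (Set.Ici 0) sqExp := by
  refine ConvexOn.mul (convexOn_pow 2) (convexOn_exp.subset (Set.subset_univ _) (convex_Ici 0))
    (fun x _ => by positivity) (fun x _ => (Real.exp_pos x).le) ?_
  intro x hx y hy hxy
  exact pow_le_pow_left₀ hx (Real.exp_lt_exp.1 hxy).le 2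

/-- The two bounds of `pow_mul_abs_cutExp_le_mul_exp` are used in the two factors of `sqExp`: the
first in the square, giving the small factor `θ²`, and the second in the exponential, giving a
Gaussian-integrable function of `z`. -/
theorem sqExp_cutExp_le {σ η z h lam : ℝ} {k : ℕ} (hσ : 0 < σ) (hσ1 : σ ≤ 1 / 4) (hk : k ≠ 0)
    (hη : 0 ≤ η) (hη2 : η ≤ 2) (hh : 0 ≤ h) (hhk : h ≤ (η * k) ^ 2 / 2) (hlam : 0 ≤ lam)
    (hlamσ : 32 * (lam * η ^ 2 * σ) ≤ 1) :
    sqExp (4 * lam * ((σ ^ 2) ^ k * |cutExp σ k (η * k * z) h - 1|)) ≤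
      256 * Real.exp 145 * (lam * σ ^ 2 * η) ^ 2 * Real.exp (1088 * (lam * σ ^ 2 * η) ^ 2) *
        Real.exp (z ^ 2 / 4) := by
  obtain ⟨h1, h2⟩ := pow_mul_abs_cutExp_le_mul_exp (z := z) hσ hσ1 hk hη hη2 hh hhk
  set f := (σ ^ 2) ^ k * |cutExp σ k (η * k * z) h - 1| with hf
  have hf0 : 0 ≤ f := by positivity
  set θ := lam * σ ^ 2 * η with hθ
  have hθ0 : 0 ≤ θ := by positivity
  have hz := abs_nonneg z
  have h3 : 4 * lam * f ≤ 16 * θ * Real.exp (3 * |z|) := by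
    have h4 : |z| + 1 ≤ Real.exp |z| := Real.add_one_le_exp _
    calc 4 * lam * f ≤ 4 * lam * (4 * σ ^ 2 * η * Real.exp |z| * Real.exp (2 * |z|)) := by
          gcongr
          exact h1.trans (by gcongr)
      _ = 16 * θ * (Real.exp |z| * Real.exp (2 * |z|)) := by rw [hθ]; ring
      _ = _ := by rw [← Real.exp_add]; ring_nf
  have h4 : 4 * lam * f ≤ 16 * θ * (|z| + 1) + z ^ 2 / 8 := by
    calc 4 * lam * f ≤ 4 * lam * (4 * σ ^ 2 * η * (|z| + 1) + σ * η ^ 2 * z ^ 2) := by gcongr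
      _ = 16 * θ * (|z| + 1) + (32 * (lam * η ^ 2 * σ)) * (z ^ 2 / 8) := by rw [hθ]; ring
      _ ≤ 16 * θ * (|z| + 1) + 1 * (z ^ 2 / 8) := by gcongr
      _ = _ := by ring
  -- Sum of `6|z| ≤ z²/16 + 144`, `16θ|z| ≤ z²/16 + 1024θ²` and `16θ ≤ 64θ² + 1`.
  have h5 : 6 * |z| + (16 * θ * (|z| + 1) + z ^ 2 / 8) ≤ 145 + 1088 * θ ^ 2 + z ^ 2 / 4 := by
    rw [← sq_abs z]
    nlinarith [sq_nonneg (|z| / 4 - 12), sq_nonneg (|z| / 4 - 32 * θ), sq_nonneg (8 * θ - 1)]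
  unfold sqExp
  calc (4 * lam * f) ^ 2 * Real.exp (4 * lam * f)
      ≤ (16 * θ * Real.exp (3 * |z|)) ^ 2 * Real.exp (16 * θ * (|z| + 1) + z ^ 2 / 8) := by
        gcongr
    _ = 256 * θ ^ 2 * Real.exp (6 * |z| + (16 * θ * (|z| + 1) + z ^ 2 / 8)) := by
        rw [mul_pow, ← Real.exp_nat_mul, Real.exp_add (6 * |z|)]
        push_cast
        ring_nf
    _ ≤ 256 * θ ^ 2 * Real.exp (145 + 1088 * θ ^ 2 + z ^ 2 / 4) := by gcongr
    _ = _ := by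
        rw [Real.exp_add, Real.exp_add]
        ring

/-! ### Truncated densities of Gaussian mixtures with rare large shifts. -/

section Mixture

variable {ι : Type*} [Fintype ι] {d : ℕ}

/-- The Gaussian mixture `∑ B, p B • N(u B, 1)` has components whose weights decay geometrically
in the size `k B` of the shift. -/
structure IsRareMixture (σ s : ℝ) (p α : ι → ℝ) (k : ι → ℕ) (u : ι → Vec d) : Prop where
  nonneg : ∀ B, 0 ≤ p B
  sum_eq_one : ∑ B, p B = 1
  majorant_nonneg : ∀ B, 0 ≤ α B
  sum_majorant_le : ∑ B, α B ≤ 1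
  le_majorant : ∀ B, k B ≠ 0 → p B ≤ α B * (σ ^ 2) ^ k B
  norm_le : ∀ B, ‖u B‖ ≤ 2 / s * k B

/-- The density, relative to the standard Gaussian measure, of a Gaussian mixture whose
components are cut off where they are large. -/
def cutDensity (σ : ℝ) (p : ι → ℝ) (k : ι → ℕ) (u : ι → Vec d) (w : Vec d) : ℝ :=
  ∑ B, p B * cutExp σ (k B) (inner ℝ w (u B)) (‖u B‖ ^ 2 / 2)

theorem measurable_cutExp_inner (σ : ℝ) (k : ℕ) (u : Vec d) (h : ℝ) :
    Measurable fun w : Vec d => cutExp σ k (inner ℝ w u) h := by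
  unfold cutExp
  exact Measurable.ite (measurableSet_le (by fun_prop) measurable_const) (by fun_prop)
    measurable_const

theorem measurable_cutDensity (σ : ℝ) (p : ι → ℝ) (k : ι → ℕ) (u : ι → Vec d) :
    Measurable (cutDensity σ p k u) :=
  Finset.measurable_sum _ fun _ _ => (measurable_cutExp_inner _ _ _ _).const_mul _

/-- The exponential moments of the part of a shifted Gaussian that is cut off. -/
theorem lintegral_exp_sub_cutExp_le {σ s : ℝ} {k : ℕ} {u : Vec d} (hσ : 0 < σ) (hs : 0 < s)
    (hk : k ≠ 0) (hu : ‖u‖ ≤ 2 / s * k) :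
    ∫⁻ w, ENNReal.ofReal (Real.exp (inner ℝ w u - ‖u‖ ^ 2 / 2) -
        cutExp σ k (inner ℝ w u) (‖u‖ ^ 2 / 2)) ∂stdGaussian (Vec d) ≤
      ENNReal.ofReal (Real.exp (128 * s ^ 2 + 32 * k + 8 * s ^ 2 * Real.log σ)) := by
  have hk0 : (0 : ℝ) < k := by exact_mod_cast Nat.pos_of_ne_zero hk
  -- Chernoff bound with slope `a`: on the cut region `⟨w, u⟩ + k log σ ≥ 0`, so a factor `exp (a
  -- (⟨w, u⟩ + k log σ))` may be inserted. The choice makes `a k = 8 s²`, and the other terms become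
  -- `128 s²` and `32 k` by the bound on `‖u‖`.
  set a := 8 * s ^ 2 / k with ha
  have ha0 : 0 ≤ a := by positivity
  have hpt : ∀ w : Vec d, Real.exp (inner ℝ w u - ‖u‖ ^ 2 / 2) -
      cutExp σ k (inner ℝ w u) (‖u‖ ^ 2 / 2) ≤
      Real.exp (inner ℝ w ((a + 1) • u)) *
        Real.exp (a * k * Real.log σ - ‖u‖ ^ 2 / 2) := by
    intro w
    unfold cutExp
    split_ifs with hc
    · rw [sub_self]; positivity
    · rw [sub_zero, ← Real.exp_add, inner_smul_right]
      refine Real.exp_le_exp.2 ?_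
      have h1 : 0 ≤ inner ℝ w u + k * Real.log σ := by
        rw [not_le, ← Real.exp_log (pow_pos hσ k), ← Real.exp_add, Real.one_lt_exp_iff,
          Real.log_pow] at hc
        exact hc.le
      nlinarith [mul_nonneg ha0 h1]
  calc _ ≤ ∫⁻ w, ENNReal.ofReal (Real.exp (inner ℝ w ((a + 1) • u))) *
        ENNReal.ofReal (Real.exp (a * k * Real.log σ - ‖u‖ ^ 2 / 2)) ∂stdGaussian (Vec d) := by
        refine lintegral_mono fun w => ?_
        rw [← ENNReal.ofReal_mul (Real.exp_pos _).le]
        exact ENNReal.ofReal_le_ofReal (hpt w)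
    _ = ENNReal.ofReal (Real.exp (‖(a + 1) • u‖ ^ 2 / 2 +
          (a * k * Real.log σ - ‖u‖ ^ 2 / 2))) := by
        rw [lintegral_mul_const _ (by fun_prop), lintegral_exp_inner_stdGaussian,
          ← ENNReal.ofReal_mul (Real.exp_pos _).le, Real.exp_add]
    _ ≤ _ := by
        refine ENNReal.ofReal_le_ofReal (Real.exp_le_exp.2 ?_)
        have hak : a * k = 8 * s ^ 2 := by rw [ha]; field_simp
        have h1 : ‖u‖ ^ 2 ≤ (2 / s * k) ^ 2 := by gcongr
        have h2 : a ^ 2 * (2 / s * k) ^ 2 = 256 * s ^ 2 := by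
          rw [ha]; field_simp; norm_num
        have h3 : a * (2 / s * k) ^ 2 = 32 * k := by
          rw [ha]; field_simp; norm_num
        rw [norm_smul, Real.norm_of_nonneg (by positivity), hak]
        have h4 : a ^ 2 * ‖u‖ ^ 2 ≤ 256 * s ^ 2 := h2 ▸ by gcongr
        have h5 : a * ‖u‖ ^ 2 ≤ 32 * k := h3 ▸ by gcongr
        nlinarith

namespace IsRareMixture

variable {σ s : ℝ} {p α : ι → ℝ} {k : ι → ℕ} {u : ι → Vec d}

theorem eq_zero (H : IsRareMixture σ s p α k u) {B : ι} (hB : k B = 0) : u B = 0 := by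
  have := H.norm_le B
  rw [hB] at this
  simpa using this

theorem cutExp_eq_one (H : IsRareMixture σ s p α k u) {B : ι} (hB : k B = 0) (w : Vec d) :
    cutExp σ (k B) (inner ℝ w (u B)) (‖u B‖ ^ 2 / 2) = 1 := by
  simp [H.eq_zero hB, hB, cutExp]

/-- Components with `k B = 0` are unshifted and uncut, hence contribute nothing to the deviation;
this is why their weights need no majorant. -/
theorem abs_cutDensity_sub_one_le (H : IsRareMixture σ s p α k u) (w : Vec d) :
    |cutDensity σ p k u w - 1| ≤ ∑ B, α B * ((σ ^ 2) ^ k B *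
      |cutExp σ (k B) (inner ℝ w (u B)) (‖u B‖ ^ 2 / 2) - 1|) := by
  have h1 : cutDensity σ p k u w - 1 =
      ∑ B, p B * (cutExp σ (k B) (inner ℝ w (u B)) (‖u B‖ ^ 2 / 2) - 1) := by
    simp only [cutDensity, mul_sub_one, Finset.sum_sub_distrib, H.sum_eq_one]
  rw [h1]
  refine (Finset.abs_sum_le_sum_abs _ _).trans (Finset.sum_le_sum fun B _ => ?_)
  rw [abs_mul, abs_of_nonneg (H.nonneg B), ← mul_assoc]
  by_cases hB : k B = 0
  · simp [H.cutExp_eq_one hB]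
  · exact mul_le_mul_of_nonneg_right (H.le_majorant B hB) (abs_nonneg _)

/-- Of the two factors `σ ^ k B`, one compensates the truncation level and the other is at most `σ`.
-/
theorem pow_mul_abs_le (H : IsRareMixture σ s p α k u) (hσ : 0 < σ) (hσ1 : σ ≤ 1) (B : ι)
    (w : Vec d) :
    (σ ^ 2) ^ k B * |cutExp σ (k B) (inner ℝ w (u B)) (‖u B‖ ^ 2 / 2) - 1| ≤ σ := by
  by_cases hB : k B = 0
  · simp [H.cutExp_eq_one hB, hσ.le]
  · have h1 := pow_mul_abs_cutExp_sub_one_le_one (k := k B) (t := inner ℝ w (u B)) hσ hσ1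
      (h := ‖u B‖ ^ 2 / 2) (by positivity)
    have h2 : (σ ^ 2) ^ k B = σ ^ k B * σ ^ k B := by rw [← mul_pow, sq]
    rw [h2, mul_assoc]
    calc _ ≤ σ ^ k B * 1 := by gcongr
      _ ≤ σ := by rw [mul_one]; exact pow_le_of_le_one hσ.le hσ1 hB

theorem abs_cutDensity_sub_one_le_self (H : IsRareMixture σ s p α k u) (hσ : 0 < σ) (hσ1 : σ ≤ 1)
    (w : Vec d) : |cutDensity σ p k u w - 1| ≤ σ := by
  refine (H.abs_cutDensity_sub_one_le w).trans ?_
  calc _ ≤ ∑ B, α B * σ := Finset.sum_le_sum fun B _ =>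
        mul_le_mul_of_nonneg_left (H.pow_mul_abs_le hσ hσ1 B w) (H.majorant_nonneg B)
    _ ≤ 1 * σ := by rw [← Finset.sum_mul]; gcongr; exact H.sum_majorant_le
    _ = σ := one_mul σ

/-- Truncation only lowers the density. No error term arises in this direction, the one needed for
the mixture on the right of the privacy inequality. -/
theorem lintegral_mul_cutDensity_le (H : IsRareMixture σ s p α k u) {φ : Vec d → ENNReal}
    (hφ : Measurable φ) :
    ∫⁻ w, ENNReal.ofReal (cutDensity σ p k u w) * φ w ∂stdGaussian (Vec d) ≤
      ∑ B, ENNReal.ofReal (p B) * ∫⁻ w, φ (w + u B) ∂stdGaussian (Vec d) := by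
  have h1 : ∀ w, ENNReal.ofReal (cutDensity σ p k u w) * φ w ≤ ∑ B, ENNReal.ofReal (p B) *
      (ENNReal.ofReal (Real.exp (inner ℝ w (u B) - ‖u B‖ ^ 2 / 2)) * φ w) := by
    intro w
    rw [cutDensity, ENNReal.ofReal_sum_of_nonneg fun B _ => mul_nonneg (H.nonneg B) cutExp_nonneg,
      Finset.sum_mul]
    refine Finset.sum_le_sum fun B _ => ?_
    rw [ENNReal.ofReal_mul (H.nonneg B), mul_assoc]
    gcongr
    exact cutExp_le
  refine (lintegral_mono h1).trans ?_
  rw [lintegral_finsetSum _ fun B _ => by fun_prop]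
  refine Finset.sum_le_sum fun B _ => ?_
  rw [lintegral_const_mul _ (by fun_prop), lintegral_stdGaussian_add _ hφ]

/-- The threshold `-33` lets `k log σ` beat `32 k` and `4 s² log σ` beat `129 s²`; the remaining `4
s² log σ` is at most `4 log σ` and gives `σ ^ 4`. -/
theorem mul_exp_tail_le (H : IsRareMixture σ s p α k u) (hσ : 0 < σ)
    (hσ1 : Real.log σ ≤ -33) (hs : 1 ≤ s) {B : ι} (hB : k B ≠ 0) :
    p B * Real.exp (128 * s ^ 2 + 32 * k B + 8 * s ^ 2 * Real.log σ) ≤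
      α B * (σ ^ 4 * Real.exp (-s ^ 2)) := by
  have hk : (1 : ℝ) ≤ k B := by exact_mod_cast Nat.one_le_iff_ne_zero.2 hB
  have hpow : ∀ m : ℕ, σ ^ m = Real.exp (m * Real.log σ) := fun m => by
    rw [Real.exp_nat_mul, Real.exp_log hσ]
  calc _ ≤ (α B * (σ ^ 2) ^ k B) *
        Real.exp (128 * s ^ 2 + 32 * k B + 8 * s ^ 2 * Real.log σ) := by
        gcongr
        exact H.le_majorant B hB
    _ = α B * Real.exp (2 * k B * Real.log σ +
        (128 * s ^ 2 + 32 * k B + 8 * s ^ 2 * Real.log σ)) := by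
        rw [← pow_mul, hpow, Real.exp_add (2 * k B * Real.log σ)]
        push_cast
        ring
    _ ≤ α B * Real.exp (4 * Real.log σ + -s ^ 2) := by
        refine mul_le_mul_of_nonneg_left (Real.exp_le_exp.2 ?_) (H.majorant_nonneg B)
        have h1 : (k B : ℝ) * (Real.log σ + 33) ≤ 0 :=
          mul_nonpos_of_nonneg_of_nonpos (by linarith) (by linarith)
        have h2 : (1 : ℝ) ≤ s ^ 2 := by nlinarith
        have h3 : s ^ 2 * (Real.log σ + 33) ≤ 0 :=
          mul_nonpos_of_nonneg_of_nonpos (by linarith) (by linarith)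
        have h4 : (s ^ 2 - 1) * Real.log σ ≤ 0 :=
          mul_nonpos_of_nonneg_of_nonpos (by linarith) (by linarith)
        nlinarith
    _ = _ := by
        rw [Real.exp_add, hpow]
        norm_num

/-- Since `φ ≤ 1`, replacing the mixture by its truncated density loses at most the mass that was
cut off. -/
theorem sum_lintegral_le (H : IsRareMixture σ s p α k u) (hσ : 0 < σ)
    (hσ1 : Real.log σ ≤ -33) (hs : 1 ≤ s) {φ : Vec d → ENNReal}
    (hφ : Measurable φ) (hφ1 : ∀ w, φ w ≤ 1) :
    ∑ B, ENNReal.ofReal (p B) * ∫⁻ w, φ (w + u B) ∂stdGaussian (Vec d) ≤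
      ENNReal.ofReal (σ ^ 4 * Real.exp (-s ^ 2)) +
        ∫⁻ w, ENNReal.ofReal (cutDensity σ p k u w) * φ w ∂stdGaussian (Vec d) := by
  have hτ : 0 ≤ σ ^ 4 * Real.exp (-s ^ 2) := by positivity
  have hterm : ∀ B, ENNReal.ofReal (p B) * ∫⁻ w, φ (w + u B) ∂stdGaussian (Vec d) ≤
      ENNReal.ofReal (α B * (σ ^ 4 * Real.exp (-s ^ 2))) +
      ∫⁻ w, ENNReal.ofReal (p B * cutExp σ (k B) (inner ℝ w (u B)) (‖u B‖ ^ 2 / 2)) * φ w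
        ∂stdGaussian (Vec d) := by
    intro B
    by_cases hB : k B = 0
    · simp only [H.cutExp_eq_one hB, mul_one]
      simp only [H.eq_zero hB, add_zero]
      rw [lintegral_const_mul _ hφ]
      exact le_add_self
    · rw [lintegral_stdGaussian_add _ hφ]
      have hm := measurable_cutExp_inner σ (k B) (u B) (‖u B‖ ^ 2 / 2)
      have h1 : ∀ w, ENNReal.ofReal (Real.exp (inner ℝ w (u B) - ‖u B‖ ^ 2 / 2)) * φ w ≤
          ENNReal.ofReal (Real.exp (inner ℝ w (u B) - ‖u B‖ ^ 2 / 2) -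
            cutExp σ (k B) (inner ℝ w (u B)) (‖u B‖ ^ 2 / 2)) +
          ENNReal.ofReal (cutExp σ (k B) (inner ℝ w (u B)) (‖u B‖ ^ 2 / 2)) * φ w := by
        intro w
        have h2 : Real.exp (inner ℝ w (u B) - ‖u B‖ ^ 2 / 2) =
            (Real.exp (inner ℝ w (u B) - ‖u B‖ ^ 2 / 2) -
              cutExp σ (k B) (inner ℝ w (u B)) (‖u B‖ ^ 2 / 2)) +
            cutExp σ (k B) (inner ℝ w (u B)) (‖u B‖ ^ 2 / 2) := by ring
        conv_lhs => rw [h2, ENNReal.ofReal_add (sub_nonneg.2 cutExp_le) cutExp_nonneg, add_mul]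
        gcongr
        exact mul_le_of_le_one_right' (hφ1 w)
      calc _ ≤ ENNReal.ofReal (p B) * (ENNReal.ofReal
              (Real.exp (128 * s ^ 2 + 32 * k B + 8 * s ^ 2 * Real.log σ)) +
            ∫⁻ w, ENNReal.ofReal (cutExp σ (k B) (inner ℝ w (u B)) (‖u B‖ ^ 2 / 2)) * φ w
              ∂stdGaussian (Vec d)) := by
            gcongr
            refine (lintegral_mono h1).trans ?_
            rw [lintegral_add_left (by fun_prop)]
            gcongr
            exact lintegral_exp_sub_cutExp_le hσ (by linarith) hB (H.norm_le B)
        _ ≤ _ := by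
            rw [mul_add, ← ENNReal.ofReal_mul (H.nonneg B), ← lintegral_const_mul _ (by fun_prop)]
            refine add_le_add (ENNReal.ofReal_le_ofReal (H.mul_exp_tail_le hσ hσ1 hs hB)) ?_
            refine lintegral_mono fun w => ?_
            rw [← mul_assoc, ENNReal.ofReal_mul (H.nonneg B)]
  refine (Finset.sum_le_sum fun B _ => hterm B).trans ?_
  rw [Finset.sum_add_distrib]
  refine add_le_add ?_ (le_of_eq ?_)
  · rw [← ENNReal.ofReal_sum_of_nonneg fun B _ => mul_nonneg (H.majorant_nonneg B) hτ,
      ← Finset.sum_mul]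
    exact ENNReal.ofReal_le_ofReal (mul_le_of_le_one_left hτ H.sum_majorant_le)
  · rw [← lintegral_finsetSum _ fun B _ => by
      have hm := measurable_cutExp_inner σ (k B) (u B) (‖u B‖ ^ 2 / 2)
      fun_prop]
    refine lintegral_congr fun w => ?_
    rw [cutDensity, ENNReal.ofReal_sum_of_nonneg fun B _ => mul_nonneg (H.nonneg B) cutExp_nonneg,
      Finset.sum_mul]

theorem cutDensity_nonneg (H : IsRareMixture σ s p α k u) (w : Vec d) :
    0 ≤ cutDensity σ p k u w :=
  Finset.sum_nonneg fun B _ => mul_nonneg (H.nonneg B) cutExp_nonneg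

theorem integrable_comp (H : IsRareMixture σ s p α k u) (hσ : 0 < σ) (hσ1 : σ ≤ 1)
    {f : ℝ → ℝ} (hf : Continuous f) :
    Integrable (fun w => f (cutDensity σ p k u w)) (stdGaussian (Vec d)) := by
  obtain ⟨C, hC⟩ := (isCompact_Icc (a := (1 : ℝ) - σ) (b := 1 + σ)).exists_bound_of_continuousOn
    hf.continuousOn
  refine Integrable.of_bound (hf.measurable.comp (measurable_cutDensity σ p k u)).aestronglyMeasurable
    C (Filter.Eventually.of_forall fun w => hC _ ?_)
  have := abs_le.1 (H.abs_cutDensity_sub_one_le_self hσ hσ1 w)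
  constructor <;> linarith

theorem integral_cutDensity_le_one (H : IsRareMixture σ s p α k u) :
    ∫ w, cutDensity σ p k u w ∂stdGaussian (Vec d) ≤ 1 := by
  rw [integral_eq_lintegral_of_nonneg_ae (Filter.Eventually.of_forall H.cutDensity_nonneg)
    (measurable_cutDensity σ p k u).aestronglyMeasurable]
  have h := H.lintegral_mul_cutDensity_le (φ := fun _ => 1) measurable_const
  simp only [mul_one, lintegral_one, measure_univ] at h
  rw [← ENNReal.ofReal_sum_of_nonneg fun B _ => H.nonneg B, H.sum_eq_one] at h
  exact ENNReal.toReal_le_of_le_ofReal zero_le_one h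

theorem one_sub_le_integral_cutDensity (H : IsRareMixture σ s p α k u) (hσ : 0 < σ)
    (hσ1 : Real.log σ ≤ -33) (hs : 1 ≤ s) :
    1 - σ ^ 4 * Real.exp (-s ^ 2) ≤ ∫ w, cutDensity σ p k u w ∂stdGaussian (Vec d) := by
  have hσ' : σ ≤ 1 := by
    rw [← Real.exp_log hσ]; exact Real.exp_le_one_iff.2 (by linarith)
  have h := H.sum_lintegral_le hσ hσ1 hs (φ := fun _ => 1) measurable_const fun _ => le_rfl
  simp only [mul_one, lintegral_one, measure_univ] at h
  rw [← ENNReal.ofReal_sum_of_nonneg fun B _ => H.nonneg B, H.sum_eq_one,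
    ← ofReal_integral_eq_lintegral_ofReal (f := cutDensity σ p k u)
      (H.integrable_comp hσ hσ' continuous_id)
      (Filter.Eventually.of_forall H.cutDensity_nonneg),
    ← ENNReal.ofReal_add (by positivity) (integral_nonneg H.cutDensity_nonneg),
    ENNReal.ofReal_le_ofReal_iff (add_nonneg (by positivity) (integral_nonneg H.cutDensity_nonneg))] at h
  linarith

theorem continuous_sqExp_abs (c : ℝ) : Continuous fun x : ℝ => sqExp (c * |x - 1|) := by
  unfold sqExp
  fun_prop

/-- Convexity of `sqExp` moves it inside the sum over components, where each term depends on a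
single Gaussian variable and `lintegral_exp_inner_sq_le` applies. The bound does not depend on the
number of components or on the dimension. -/
theorem integral_sqExp_le (H : IsRareMixture σ s p α k u) (hσ : 0 < σ) (hσ1 : σ ≤ 1 / 4)
    (hs : 1 ≤ s) {lam : ℝ} (hlam : 0 ≤ lam) (hlamσ : 32 * (lam * (2 / s) ^ 2 * σ) ≤ 1) :
    ∫ w, sqExp (4 * lam * |cutDensity σ p k u w - 1|) ∂stdGaussian (Vec d) ≤
      512 * Real.exp 145 * (lam * σ ^ 2 * (2 / s)) ^ 2 *
        Real.exp (1088 * (lam * σ ^ 2 * (2 / s)) ^ 2) := by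
  set b := 256 * Real.exp 145 * (lam * σ ^ 2 * (2 / s)) ^ 2 *
        Real.exp (1088 * (lam * σ ^ 2 * (2 / s)) ^ 2) with hb
  have hb0 : 0 ≤ b := by positivity
  have hs0 : 0 < s := by linarith
  set f : ι → Vec d → ℝ := fun B w => (σ ^ 2) ^ k B *
      |cutExp σ (k B) (inner ℝ w (u B)) (‖u B‖ ^ 2 / 2) - 1| with hf
  have hf0 : ∀ B w, 0 ≤ f B w := fun B w => by positivity
  have hterm : ∀ B, ∫⁻ w, ENNReal.ofReal (sqExp (4 * lam * f B w)) ∂stdGaussian (Vec d) ≤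
      ENNReal.ofReal (b * 2) := by
    intro B
    by_cases hB : k B = 0
    · simp [hf, H.cutExp_eq_one hB, sqExp]
    have hk0 : (0 : ℝ) < k B := by exact_mod_cast Nat.pos_of_ne_zero hB
    set c := 2 / s * (k B : ℝ) with hc
    have hc0 : 0 < c := by positivity
    have hv : ‖c⁻¹ • u B‖ ≤ 1 := by
      rw [norm_smul, norm_inv, Real.norm_of_nonneg hc0.le, inv_mul_le_one₀ hc0]
      exact H.norm_le B
    calc _ ≤ ∫⁻ w, ENNReal.ofReal b * ENNReal.ofReal (Real.exp ((inner ℝ w (c⁻¹ • u B)) ^ 2 / 4))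
          ∂stdGaussian (Vec d) := by
          refine lintegral_mono fun w => ?_
          rw [← ENNReal.ofReal_mul hb0]
          refine ENNReal.ofReal_le_ofReal ?_
          have h1 : inner ℝ w (u B) = 2 / s * k B * inner ℝ w (c⁻¹ • u B) := by
            rw [inner_smul_right, ← hc, mul_inv_cancel_left₀ hc0.ne']
          simp only [hf]
          rw [h1]
          refine sqExp_cutExp_le hσ hσ1 hB (by positivity) ?_ (by positivity) ?_ hlam hlamσ
          · rw [div_le_iff₀ hs0]; linarith
          · have := H.norm_le B
            gcongr
      _ ≤ ENNReal.ofReal b * 2 := by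
          rw [lintegral_const_mul _ (by fun_prop)]
          gcongr
          exact lintegral_exp_inner_sq_le hv
      _ = ENNReal.ofReal (b * 2) := by rw [ENNReal.ofReal_mul hb0]; simp
  have hconv : ∀ w, sqExp (4 * lam * |cutDensity σ p k u w - 1|) ≤
      ∑ B, α B * sqExp (4 * lam * f B w) := by
    intro w
    have h1 : 4 * lam * |cutDensity σ p k u w - 1| ≤ ∑ B, α B • (4 * lam * f B w) := by
      calc _ ≤ 4 * lam * ∑ B, α B * f B w := by
            gcongr
            exact H.abs_cutDensity_sub_one_le w
        _ = _ := by
            rw [Finset.mul_sum]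
            refine Finset.sum_congr rfl fun B _ => ?_
            simp only [smul_eq_mul]
            ring
    refine (sqExp_mono (by positivity) h1).trans ?_
    -- The majorants sum to at most 1; the missing weight is put on an extra point `none` with value
    -- 0, where `sqExp` vanishes.
    have h2 := convexOn_sqExp.map_sum_le (t := Finset.univ)
      (w := fun o : Option ι => o.elim (1 - ∑ B, α B) α)
      (p := fun o : Option ι => o.elim 0 fun B => 4 * lam * f B w) ?_ ?_ ?_
    · simpa [sqExp, Fintype.sum_option] using h2
    · rintro (_ | B) _
      · simpa using H.sum_majorant_le
      · exact H.majorant_nonneg B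
    · simp [Fintype.sum_option]
    · rintro (_ | B) _
      · simp
      · have := hf0 B w
        simp only [Option.elim, Set.mem_Ici]
        positivity
  have hfm : ∀ B, Measurable (f B) := fun B => by
    have hm := measurable_cutExp_inner σ (k B) (u B) (‖u B‖ ^ 2 / 2)
    have : Measurable fun w : Vec d =>
        |cutExp σ (k B) (inner ℝ w (u B)) (‖u B‖ ^ 2 / 2) - 1| := by
      simp_rw [← Real.norm_eq_abs]
      fun_prop
    exact this.const_mul _
  have hsq : Measurable sqExp := by unfold sqExp; fun_prop
  have hsm : ∀ B, Measurable fun w => ENNReal.ofReal (sqExp (4 * lam * f B w)) := fun B =>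
    (hsq.comp ((hfm B).const_mul _)).ennreal_ofReal
  rw [integral_eq_lintegral_of_nonneg_ae (Filter.Eventually.of_forall fun w => sqExp_nonneg _)
    ((continuous_sqExp_abs _).measurable.comp (measurable_cutDensity σ p k u)).aestronglyMeasurable]
  have hfin : b * 2 = 512 * Real.exp 145 * (lam * σ ^ 2 * (2 / s)) ^ 2 *
        Real.exp (1088 * (lam * σ ^ 2 * (2 / s)) ^ 2) := by rw [hb]; ring
  rw [← hfin]
  refine ENNReal.toReal_le_of_le_ofReal (by positivity) ?_
  calc _ ≤ ∫⁻ w, ∑ B, ENNReal.ofReal (α B) * ENNReal.ofReal (sqExp (4 * lam * f B w))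
        ∂stdGaussian (Vec d) := by
        refine lintegral_mono fun w => (ENNReal.ofReal_le_ofReal (hconv w)).trans ?_
        rw [ENNReal.ofReal_sum_of_nonneg fun B _ =>
          mul_nonneg (H.majorant_nonneg B) (sqExp_nonneg _)]
        exact (Finset.sum_congr rfl fun B _ => ENNReal.ofReal_mul (H.majorant_nonneg B)).le
    _ = ∑ B, ENNReal.ofReal (α B) * ∫⁻ w, ENNReal.ofReal (sqExp (4 * lam * f B w))
        ∂stdGaussian (Vec d) := by
        rw [lintegral_finsetSum _ fun B _ => (hsm B).const_mul _]
        exact Finset.sum_congr rfl fun B _ => lintegral_const_mul _ (hsm B)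
    _ ≤ ∑ B, ENNReal.ofReal (α B) * ENNReal.ofReal (b * 2) := by
        gcongr with B
        exact hterm B
    _ ≤ 1 * ENNReal.ofReal (b * 2) := by
        rw [← Finset.sum_mul, ← ENNReal.ofReal_sum_of_nonneg fun B _ => H.majorant_nonneg B]
        gcongr
        exact ENNReal.ofReal_le_one.2 H.sum_majorant_le
    _ = _ := one_mul _

end IsRareMixture

/-! ### The Rényi divergence of two rare mixtures. -/

/-- The absolute constant in the Rényi divergence bound for Gaussian mixtures. -/
def renyiConst : ℝ := 1536 * Real.exp 145 + 1088

theorem renyiConst_pos : 0 < renyiConst := by unfold renyiConst; positivity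

theorem sub_two_mul_sq_le_log {x : ℝ} (hx : -(1 / 2) ≤ x) : x - 2 * x ^ 2 ≤ Real.log (1 + x) := by
  have h0 : 0 < 1 + x := by linarith
  refine le_trans ?_ (Real.one_sub_inv_le_log_of_pos h0)
  have h1 : (1 + x)⁻¹ ≤ 1 - x + 2 * x ^ 2 := by
    rw [inv_le_iff_one_le_mul₀ h0]
    nlinarith [sq_nonneg x, mul_nonneg (sq_nonneg x) (by linarith : 0 ≤ 1 + 2 * x)]
  linarith

/-- A bound on the exponential moment of the log-likelihood ratio of two rare mixtures. -/
theorem integral_exp_le {σ s lam : ℝ} {p α : ι → ℝ} {k : ι → ℕ} {u u' : ι → Vec d}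
    (H : IsRareMixture σ s p α k u) (H' : IsRareMixture σ s p α k u') (hσ : 0 < σ)
    (hσ1 : Real.log σ ≤ -33) (hs : 1 ≤ s) (hlam : 1 ≤ lam)
    (hlamσ : 32 * (lam * (2 / s) ^ 2 * σ) ≤ 1) :
    ∫ w, Real.exp ((1 + lam) * (cutDensity σ p k u w - 1) - lam * (cutDensity σ p k u' w - 1) +
        2 * lam * (cutDensity σ p k u' w - 1) ^ 2) ∂stdGaussian (Vec d) ≤
      Real.exp (lam * (σ ^ 4 * Real.exp (-s ^ 2)) +
        renyiConst * (lam * σ ^ 2 * (2 / s)) ^ 2) := by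
  have hσ4 : σ ≤ 1 / 4 := by
    rw [← Real.exp_log hσ]
    calc Real.exp (Real.log σ) ≤ Real.exp (-33) := Real.exp_le_exp.2 hσ1
      _ ≤ 1 / 4 := by
        rw [Real.exp_neg, one_div]
        exact inv_anti₀ (by norm_num) (by linarith [Real.add_one_le_exp (33 : ℝ)])
  have hσ' : σ ≤ 1 := by linarith
  set X := fun w => cutDensity σ p k u w - 1 with hX
  set X' := fun w => cutDensity σ p k u' w - 1 with hX'
  set τ := σ ^ 4 * Real.exp (-s ^ 2) with hτ
  set θ := lam * σ ^ 2 * (2 / s) with hθ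
  set b := 512 * Real.exp 145 * θ ^ 2 * Real.exp (1088 * θ ^ 2) with hb
  have hτ0 : 0 ≤ τ := by positivity
  have hXi : Integrable X (stdGaussian (Vec d)) :=
    H.integrable_comp hσ hσ' (f := fun x => x - 1) (by fun_prop)
  have hXi' : Integrable X' (stdGaussian (Vec d)) :=
    H'.integrable_comp hσ hσ' (f := fun x => x - 1) (by fun_prop)
  have hE : Integrable (fun w => sqExp (4 * lam * |X w|)) (stdGaussian (Vec d)) :=
    H.integrable_comp hσ hσ' (IsRareMixture.continuous_sqExp_abs _)
  have hE' : Integrable (fun w => sqExp (4 * lam * |X' w|)) (stdGaussian (Vec d)) :=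
    H'.integrable_comp hσ hσ' (IsRareMixture.continuous_sqExp_abs _)
  -- Because `|X'| ≤ 1/2` and `1 + lam ≤ 2 lam`, the exponent is at most the mean of `4 lam |X|` and
  -- `4 lam |X'|` in absolute value, and convexity of `sqExp` splits the quadratic remainder between
  -- the two. The term `2 lam X'²` is itself at most one `sqExp`.
  have hpt : ∀ w, Real.exp ((1 + lam) * X w - lam * X' w + 2 * lam * X' w ^ 2) ≤
      1 + ((1 + lam) * X w - lam * X' w) +
        (sqExp (4 * lam * |X w|) + 2 * sqExp (4 * lam * |X' w|)) := by
    intro w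
    set y := (1 + lam) * X w - lam * X' w + 2 * lam * X' w ^ 2 with hy
    have hx' : |X' w| ≤ 1 / 2 := (H'.abs_cutDensity_sub_one_le_self hσ hσ' w).trans (by linarith)
    have ha := abs_nonneg (X w)
    have ha' := abs_nonneg (X' w)
    have hyabs : |y| ≤ 1 / 2 * (4 * lam * |X w|) + 1 / 2 * (4 * lam * |X' w|) := by
      have h1 : X' w ^ 2 ≤ 1 / 2 * |X' w| := by rw [← sq_abs]; nlinarith
      have h2 : 2 * lam * X' w ^ 2 ≤ lam * |X' w| := by nlinarith
      have h3 : (1 + lam) * |X w| ≤ 2 * lam * |X w| := by gcongr; linarith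
      have h4 : |(1 + lam) * X w| = (1 + lam) * |X w| := by
        rw [abs_mul, abs_of_nonneg (by linarith)]
      have h5 : |lam * X' w| = lam * |X' w| := by rw [abs_mul, abs_of_nonneg (by linarith)]
      have h6 : |2 * lam * X' w ^ 2| = 2 * lam * X' w ^ 2 := abs_of_nonneg (by positivity)
      calc |y| ≤ |(1 + lam) * X w - lam * X' w| + |2 * lam * X' w ^ 2| := abs_add_le _ _
        _ ≤ |(1 + lam) * X w| + |lam * X' w| + |2 * lam * X' w ^ 2| := by
          gcongr; exact abs_sub _ _
        _ ≤ _ := by linarith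
    have h1 : y ^ 2 * Real.exp |y| ≤
        1 / 2 * sqExp (4 * lam * |X w|) + 1 / 2 * sqExp (4 * lam * |X' w|) := by
      have h2 := sqExp_mono (abs_nonneg y) hyabs
      have h3 := convexOn_sqExp.2
        (Set.mem_Ici.2 (by positivity : 0 ≤ 4 * lam * |X w|))
        (Set.mem_Ici.2 (by positivity : 0 ≤ 4 * lam * |X' w|))
        (by norm_num : (0 : ℝ) ≤ 1 / 2) (by norm_num : (0 : ℝ) ≤ 1 / 2) (by norm_num)
      simp only [smul_eq_mul] at h3
      have h4 : sqExp |y| = y ^ 2 * Real.exp |y| := by rw [sqExp, sq_abs]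
      linarith
    have h5 : 2 * lam * X' w ^ 2 ≤ sqExp (4 * lam * |X' w|) := by
      unfold sqExp
      have h6 : 1 ≤ Real.exp (4 * lam * |X' w|) := Real.one_le_exp (by positivity)
      calc 2 * lam * X' w ^ 2 ≤ (4 * lam * |X' w|) ^ 2 * 1 := by
            rw [mul_pow, sq_abs]
            nlinarith [mul_nonneg (sq_nonneg (X' w)) (by nlinarith : 0 ≤ 16 * lam ^ 2 - 2 * lam)]
        _ ≤ _ := by gcongr
    have h7 := exp_le_one_add_add_sq_mul y
    have h8 := sqExp_nonneg (4 * lam * |X w|)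
    have h9 := sqExp_nonneg (4 * lam * |X' w|)
    linarith
  have hi1 : ∫ w, X w ∂stdGaussian (Vec d) ≤ 0 := by
    have := H.integral_cutDensity_le_one
    have hi := H.integrable_comp hσ hσ' continuous_id
    simp only [id] at hi
    rw [hX, integral_sub hi (integrable_const _)]
    simpa using this
  have hi2 : -τ ≤ ∫ w, X' w ∂stdGaussian (Vec d) := by
    have := H'.one_sub_le_integral_cutDensity hσ hσ1 hs
    have hi := H'.integrable_comp hσ hσ' continuous_id
    simp only [id] at hi
    rw [hX', integral_sub hi (integrable_const _)]
    simp only [integral_const, probReal_univ, smul_eq_mul, mul_one]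
    linarith
  have hi3 := H.integral_sqExp_le hσ hσ4 hs (by linarith) hlamσ
  have hi4 := H'.integral_sqExp_le hσ hσ4 hs (by linarith) hlamσ
  have hEE : Integrable (fun w => sqExp (4 * lam * |X w|) + 2 * sqExp (4 * lam * |X' w|))
    (stdGaussian (Vec d)) := hE.add (hE'.const_mul 2)
  have hlin : Integrable (fun w => (1 + lam) * X w - lam * X' w) (stdGaussian (Vec d)) :=
    (hXi.const_mul _).sub (hXi'.const_mul _)
  have hlin1 : Integrable (fun w => 1 + ((1 + lam) * X w - lam * X' w)) (stdGaussian (Vec d)) :=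
    (integrable_const _).add hlin
  calc _ ≤ ∫ w, (1 + ((1 + lam) * X w - lam * X' w) +
        (sqExp (4 * lam * |X w|) + 2 * sqExp (4 * lam * |X' w|))) ∂stdGaussian (Vec d) :=
        integral_mono_of_nonneg (Filter.Eventually.of_forall fun w => (Real.exp_pos _).le)
          (hlin1.add hEE) (Filter.Eventually.of_forall hpt)
    _ = 1 + ((1 + lam) * ∫ w, X w ∂stdGaussian (Vec d) - lam * ∫ w, X' w ∂stdGaussian (Vec d)) +
        (∫ w, sqExp (4 * lam * |X w|) ∂stdGaussian (Vec d) +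
          2 * ∫ w, sqExp (4 * lam * |X' w|) ∂stdGaussian (Vec d)) := by
        rw [integral_add hlin1 hEE, integral_add (integrable_const _) hlin,
          integral_sub (hXi.const_mul _) (hXi'.const_mul _), integral_add hE (hE'.const_mul 2),
          integral_const_mul, integral_const_mul, integral_const_mul]
        simp
    -- The first-order terms almost cancel: the truncated densities have mass at most 1 and at least
    -- `1 - τ`.
    _ ≤ 1 + lam * τ + 3 * b := by
        have h1 : (1 + lam) * ∫ w, X w ∂stdGaussian (Vec d) ≤ 0 :=
          mul_nonpos_of_nonneg_of_nonpos (by linarith) hi1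
        have h2 : lam * (-τ) ≤ lam * ∫ w, X' w ∂stdGaussian (Vec d) := by gcongr
        linarith
    _ ≤ _ := by
        have h1 : lam * τ + renyiConst * θ ^ 2 =
            (lam * τ + 1536 * Real.exp 145 * θ ^ 2) + 1088 * θ ^ 2 := by
          rw [renyiConst]; ring
        have h2 := Real.add_one_le_exp (lam * τ + 1536 * Real.exp 145 * θ ^ 2)
        have h3 : 1 ≤ Real.exp (1088 * θ ^ 2) := Real.one_le_exp (by positivity)
        have h4 : 0 ≤ lam * τ := by positivity
        rw [h1, Real.exp_add]
        calc 1 + lam * τ + 3 * b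
            ≤ (lam * τ + 1536 * Real.exp 145 * θ ^ 2 + 1) * Real.exp (1088 * θ ^ 2) := by
              rw [hb]; nlinarith
          _ ≤ _ := by gcongr

/-- The Hölder form of the Rényi divergence bound for two rare mixtures. -/
theorem sum_lintegral_le_rpow {σ s lam : ℝ} {p α : ι → ℝ} {k : ι → ℕ} {u u' : ι → Vec d}
    (H : IsRareMixture σ s p α k u) (H' : IsRareMixture σ s p α k u') (hσ : 0 < σ)
    (hσ1 : Real.log σ ≤ -33) (hs : 1 ≤ s) (hlam : 1 ≤ lam)
    (hlamσ : 32 * (lam * (2 / s) ^ 2 * σ) ≤ 1) {φ : Vec d → ENNReal}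
    (hφ : Measurable φ) (hφ1 : ∀ w, φ w ≤ 1) :
    ∑ B, ENNReal.ofReal (p B) * ∫⁻ w, φ (w + u B) ∂stdGaussian (Vec d) ≤
      ENNReal.ofReal (σ ^ 4 * Real.exp (-s ^ 2)) +
      ENNReal.ofReal (Real.exp ((lam * (σ ^ 4 * Real.exp (-s ^ 2)) +
        renyiConst * (lam * σ ^ 2 * (2 / s)) ^ 2) / (1 + lam))) *
      (∑ B, ENNReal.ofReal (p B) * ∫⁻ w, φ (w + u' B) ^ ((1 + lam) / lam)
        ∂stdGaussian (Vec d)) ^ (lam / (1 + lam)) := by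
  refine (H.sum_lintegral_le hσ hσ1 hs hφ hφ1).trans (add_le_add le_rfl ?_)
  have hlam0 : 0 < lam := by linarith
  have hσ2 : σ ≤ 1 / 2 := by
    rw [← Real.exp_log hσ]
    calc Real.exp (Real.log σ) ≤ Real.exp (-33) := Real.exp_le_exp.2 hσ1
      _ ≤ 1 / 2 := by
        rw [Real.exp_neg, one_div]
        exact inv_anti₀ (by norm_num) (by linarith [Real.add_one_le_exp (33 : ℝ)])
  set P := cutDensity σ p k u with hP
  set Q := cutDensity σ p k u' with hQ
  have hPm : Measurable P := measurable_cutDensity _ _ _ _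
  have hQm : Measurable Q := measurable_cutDensity _ _ _ _
  have hPabs : ∀ w, |P w - 1| ≤ 1 / 2 := fun w =>
    (H.abs_cutDensity_sub_one_le_self hσ (by linarith) w).trans hσ2
  have hQabs : ∀ w, |Q w - 1| ≤ 1 / 2 := fun w =>
    (H'.abs_cutDensity_sub_one_le_self hσ (by linarith) w).trans hσ2
  have hPpos : ∀ w, 0 < P w := fun w => by linarith [(abs_le.1 (hPabs w)).1]
  have hQpos : ∀ w, 0 < Q w := fun w => by linarith [(abs_le.1 (hQabs w)).1]
  set e := lam / (1 + lam) with he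
  have he0 : 0 < e := by positivity
  have hconj : ((1 + lam) / lam).HolderConjugate (1 + lam) := by
    rw [Real.holderConjugate_iff]
    constructor
    · rw [lt_div_iff₀ hlam0]; linarith
    · field_simp
      ring
  -- The integrand is `P ^ (1 + lam) * Q ^ (-lam)`. The logarithm of `P` is bounded above to first
  -- order and that of `Q` below to second order, the latter because `Q ≥ 1/2`.
  have hexp : ∀ w, ENNReal.ofReal (P w * Q w ^ (-e)) ^ (1 + lam) ≤
      ENNReal.ofReal (Real.exp ((1 + lam) * (P w - 1) - lam * (Q w - 1) +
        2 * lam * (Q w - 1) ^ 2)) := by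
    intro w
    rw [ENNReal.ofReal_rpow_of_nonneg (by have := hPpos w; have := hQpos w; positivity)
      (by linarith)]
    refine ENNReal.ofReal_le_ofReal ?_
    rw [Real.mul_rpow (hPpos w).le (by have := hQpos w; positivity), ← Real.rpow_mul (hQpos w).le,
      Real.rpow_def_of_pos (hPpos w), Real.rpow_def_of_pos (hQpos w), ← Real.exp_add]
    refine Real.exp_le_exp.2 ?_
    have h1 : Real.log (P w) ≤ P w - 1 := Real.log_le_sub_one_of_pos (hPpos w)
    have h2 := sub_two_mul_sq_le_log (x := Q w - 1) (by linarith [(abs_le.1 (hQabs w)).1])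
    rw [add_sub_cancel] at h2
    have h3 : -e * (1 + lam) = -lam := by rw [he]; field_simp
    rw [h3]
    nlinarith
  -- Hölder with exponents `(1 + lam) / lam` and `1 + lam`, after splitting `P` so that the first
  -- factor carries exactly the weight `Q`.
  calc _ = ∫⁻ w, (φ w * ENNReal.ofReal (Q w ^ e)) * ENNReal.ofReal (P w * Q w ^ (-e))
        ∂stdGaussian (Vec d) := by
        refine lintegral_congr fun w => ?_
        rw [mul_assoc, ← ENNReal.ofReal_mul (by have := hQpos w; positivity), mul_comm]
        congr 2
        rw [mul_left_comm, ← Real.rpow_add (hQpos w)]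
        simp
    _ ≤ (∫⁻ w, (φ w * ENNReal.ofReal (Q w ^ e)) ^ ((1 + lam) / lam) ∂stdGaussian (Vec d)) ^
          (1 / ((1 + lam) / lam)) *
        (∫⁻ w, ENNReal.ofReal (P w * Q w ^ (-e)) ^ (1 + lam) ∂stdGaussian (Vec d)) ^
          (1 / (1 + lam)) := by
        refine ENNReal.lintegral_mul_le_Lp_mul_Lq _ hconj ?_ ?_ <;> fun_prop
    _ ≤ (∑ B, ENNReal.ofReal (p B) * ∫⁻ w, φ (w + u' B) ^ ((1 + lam) / lam)
          ∂stdGaussian (Vec d)) ^ e *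
        ENNReal.ofReal (Real.exp ((lam * (σ ^ 4 * Real.exp (-s ^ 2)) +
          renyiConst * (lam * σ ^ 2 * (2 / s)) ^ 2))) ^ (1 / (1 + lam)) := by
        rw [one_div_div, ← he]
        gcongr
        · refine le_trans (lintegral_mono fun w => ?_) (H'.lintegral_mul_cutDensity_le
            (φ := fun w => φ w ^ ((1 + lam) / lam)) (by fun_prop))
          rw [ENNReal.mul_rpow_of_nonneg _ _ (by positivity), mul_comm,
            ENNReal.ofReal_rpow_of_nonneg (by have := hQpos w; positivity) (by positivity),
            ← Real.rpow_mul (hQpos w).le]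
          have h3 : e * ((1 + lam) / lam) = 1 := by rw [he]; field_simp
          rw [h3, Real.rpow_one]
        · refine (lintegral_mono hexp).trans ?_
          have hi : Integrable (fun w => Real.exp ((1 + lam) * (P w - 1) - lam * (Q w - 1) +
              2 * lam * (Q w - 1) ^ 2)) (stdGaussian (Vec d)) := by
            refine Integrable.of_bound (C := Real.exp ((1 + lam) * (1 / 2) + lam * (1 / 2) +
              2 * lam * (1 / 2) ^ 2)) (by fun_prop) (Filter.Eventually.of_forall fun w => ?_)
            rw [Real.norm_of_nonneg (Real.exp_pos _).le]
            have h1 := abs_le.1 (hPabs w)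
            have h2 := abs_le.1 (hQabs w)
            have h3 : (Q w - 1) ^ 2 ≤ (1 / 2) ^ 2 := by
              rw [← sq_abs]; gcongr; exact hQabs w
            refine Real.exp_le_exp.2 ?_
            have h4 : (1 + lam) * (P w - 1) ≤ (1 + lam) * (1 / 2) := by gcongr; exact h1.2
            have h5 : lam * (-(1 / 2)) ≤ lam * (Q w - 1) := by gcongr; exact h2.1
            have h6 : 2 * lam * (Q w - 1) ^ 2 ≤ 2 * lam * (1 / 2) ^ 2 := by gcongr
            linarith
          rw [← ofReal_integral_eq_lintegral_ofReal hi
            (Filter.Eventually.of_forall fun w => (Real.exp_pos _).le)]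
          exact ENNReal.ofReal_le_ofReal (integral_exp_le H H' hσ hσ1 hs hlam hlamσ)
    _ = _ := by
        rw [mul_comm, ENNReal.ofReal_rpow_of_pos (Real.exp_pos _), ← Real.exp_mul, mul_one_div]

end Mixture

/-! ### Hölder closeness -/

/-- The laws of `f` and `f'` under `P` are close: up to an error `τ`, their Rényi divergence of
order `1 + lam` is at most `G / lam`. This is expressed by Hölder's inequality for test functions. -/
def IsHoelderClose (lam τ G : ℝ) {Ω W : Type*} [MeasurableSpace Ω] [MeasurableSpace W]
    (P : Measure Ω) (f f' : Ω → W) : Prop :=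
  ∀ φ : W → ENNReal, Measurable φ → (∀ y, φ y ≤ 1) →
    ∫⁻ ω, φ (f ω) ∂P ≤ ENNReal.ofReal τ + ENNReal.ofReal (Real.exp (G / (1 + lam))) *
      (∫⁻ ω, φ (f' ω) ^ ((1 + lam) / lam) ∂P) ^ (lam / (1 + lam))

namespace IsHoelderClose

variable {lam τ G τ₁ G₁ τ₂ G₂ : ℝ} {Ω Ω₁ Ω₂ W W₁ W₂ : Type*} [MeasurableSpace Ω] [MeasurableSpace Ω₁]
  [MeasurableSpace Ω₂] [MeasurableSpace W] [MeasurableSpace W₁] [MeasurableSpace W₂]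

theorem mono {P : Measure Ω} {f f' : Ω → W} (h : IsHoelderClose lam τ₁ G₁ P f f')
    (hlam : 0 < lam) (hτ : τ₁ ≤ τ₂) (hG : G₁ ≤ G₂) : IsHoelderClose lam τ₂ G₂ P f f' := by
  intro φ hφ hφ1
  refine (h φ hφ hφ1).trans ?_
  gcongr

theorem const (hlam : 0 < lam) (hG : 0 ≤ G) (P : Measure Ω) [IsProbabilityMeasure P] (y : W) :
    IsHoelderClose lam τ G P (fun _ => y) (fun _ => y) := by
  intro φ _ _
  simp only [lintegral_const, measure_univ, mul_one]
  rw [← ENNReal.rpow_mul, div_mul_div_cancel₀ hlam.ne', div_self (by positivity), ENNReal.rpow_one]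
  refine le_add_left (le_mul_of_one_le_left' ?_)
  rw [ENNReal.one_le_ofReal]
  exact Real.one_le_exp (by positivity)

theorem comp {P : Measure Ω} {f f' : Ω → W₁} (h : IsHoelderClose lam τ G P f f') {ψ : W₁ → W}
    (hψ : Measurable ψ) :
    IsHoelderClose lam τ G P (fun ω => ψ (f ω)) (fun ω => ψ (f' ω)) :=
  fun φ hφ hφ1 => h (fun y => φ (ψ y)) (hφ.comp hψ) fun _ => hφ1 _

/-- Adaptive composition. -/
theorem prod {P₁ : Measure Ω₁} {P₂ : Measure Ω₂} [IsProbabilityMeasure P₂]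
    {f f' : Ω₁ → W₁} {g g' : W₁ → Ω₂ → W₂} (hlam : 0 < lam)
    (hf : Measurable f) (hf' : Measurable f')
    (hg : Measurable (Function.uncurry g)) (hg' : Measurable (Function.uncurry g'))
    (h₁ : IsHoelderClose lam τ₁ G₁ P₁ f f') (h₂ : ∀ y, IsHoelderClose lam τ₂ G₂ P₂ (g y) (g' y))
    [IsProbabilityMeasure P₁] (hτ₁ : 0 ≤ τ₁) (hτ₂ : 0 ≤ τ₂) :
    IsHoelderClose lam (τ₂ + Real.exp (G₂ / (1 + lam)) * τ₁) (G₁ + G₂) (P₁.prod P₂)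
      (fun ω => (f ω.1, g (f ω.1) ω.2)) (fun ω => (f' ω.1, g' (f' ω.1) ω.2)) := by
  intro φ hφ hφ1
  set r := (1 + lam) / lam with hr
  set e := lam / (1 + lam) with he
  have hre : r * e = 1 := by rw [hr, he]; field_simp
  have hr0 : 0 ≤ r := by positivity
  have he0 : 0 ≤ e := by positivity
  -- The right side of the second comparison is again a test function bounded by 1, so the first
  -- comparison applies to it; since `r * e = 1`, its `r`-th power restores the inner integral.
  set ψ : W₁ → ENNReal := fun y => (∫⁻ ω, φ (y, g' y ω) ^ r ∂P₂) ^ e with hψ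
  have hψm : Measurable ψ := by
    refine Measurable.pow_const ?_ _
    refine Measurable.lintegral_prod_right' (f := fun q : W₁ × Ω₂ => φ (q.1, g' q.1 q.2) ^ r) ?_
    exact (hφ.comp (measurable_fst.prodMk hg')).pow_const _
  have hψ1 : ∀ y, ψ y ≤ 1 := by
    intro y
    refine ENNReal.rpow_le_one ?_ he0
    calc _ ≤ ∫⁻ _, 1 ∂P₂ := lintegral_mono fun ω => ENNReal.rpow_le_one (hφ1 _) hr0
      _ = 1 := by simp
  have hm : Measurable fun ω : Ω₁ × Ω₂ => φ (f ω.1, g (f ω.1) ω.2) :=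
    hφ.comp ((hf.comp measurable_fst).prodMk
      (hg.comp ((hf.comp measurable_fst).prodMk measurable_snd)))
  have hm' : Measurable fun ω : Ω₁ × Ω₂ => φ (f' ω.1, g' (f' ω.1) ω.2) ^ r :=
    (hφ.comp ((hf'.comp measurable_fst).prodMk
      (hg'.comp ((hf'.comp measurable_fst).prodMk measurable_snd)))).pow_const _
  calc _ = ∫⁻ ω₁, ∫⁻ ω₂, φ (f ω₁, g (f ω₁) ω₂) ∂P₂ ∂P₁ := lintegral_prod _ hm.aemeasurable
    _ ≤ ∫⁻ ω₁, (ENNReal.ofReal τ₂ + ENNReal.ofReal (Real.exp (G₂ / (1 + lam))) * ψ (f ω₁)) ∂P₁ :=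
        lintegral_mono fun ω₁ => h₂ (f ω₁) (fun z => φ (f ω₁, z))
          (hφ.comp measurable_prodMk_left) fun z => hφ1 _
    _ = ENNReal.ofReal τ₂ +
        ENNReal.ofReal (Real.exp (G₂ / (1 + lam))) * ∫⁻ ω₁, ψ (f ω₁) ∂P₁ := by
        rw [lintegral_add_left measurable_const, lintegral_const_mul _ (show Measurable fun ω => ψ (f ω) from hψm.comp hf)]
        simp
    _ ≤ ENNReal.ofReal τ₂ + ENNReal.ofReal (Real.exp (G₂ / (1 + lam))) * (ENNReal.ofReal τ₁ +
        ENNReal.ofReal (Real.exp (G₁ / (1 + lam))) * (∫⁻ ω, ψ (f' ω) ^ r ∂P₁) ^ e) := by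
        gcongr
        exact h₁ ψ hψm hψ1
    _ = _ := by
        rw [lintegral_prod _ hm'.aemeasurable, mul_add, ← add_assoc,
          ← ENNReal.ofReal_mul (Real.exp_pos _).le, ← ENNReal.ofReal_add hτ₂ (by positivity),
          ← mul_assoc, ← ENNReal.ofReal_mul (Real.exp_pos _).le, ← Real.exp_add, ← add_div,
          add_comm G₂ G₁]
        congr 3
        refine lintegral_congr fun ω₁ => ?_
        simp only [hψ]
        rw [← ENNReal.rpow_mul, mul_comm e r, hre, ENNReal.rpow_one]

/-- Hölder closeness implies approximate differential privacy. -/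
theorem measure_le {P : Measure Ω} {f f' : Ω → W} (h : IsHoelderClose lam τ G P f f')
    (hlam : 0 < lam) (hf : Measurable f) (hf' : Measurable f') (ε : ℝ) {O : Set W}
    (hO : MeasurableSet O) :
    P {ω | f ω ∈ O} ≤ ENNReal.ofReal (Real.exp ε) * P {ω | f' ω ∈ O} +
      (ENNReal.ofReal τ + ENNReal.ofReal (Real.exp (G - lam * ε))) := by
  classical
  have h1 := h (O.indicator 1) (measurable_one.indicator hO)
    fun y => Set.indicator_le' (fun _ _ => le_rfl) (fun _ _ => zero_le) y
  have h2 : ∀ f : Ω → W, Measurable f → ∀ a : ℝ, 0 < a →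
      ∫⁻ ω, (O.indicator 1 (f ω) : ENNReal) ^ a ∂P = P {ω | f ω ∈ O} := by
    intro f hf a ha
    have : ∀ ω, (O.indicator 1 (f ω) : ENNReal) ^ a = {ω | f ω ∈ O}.indicator 1 ω := by
      intro ω
      by_cases hω : f ω ∈ O <;> simp [hω, ha]
    simp_rw [this]
    exact lintegral_indicator_one (hf hO)
  have h3 := h2 f hf 1 one_pos
  simp only [ENNReal.rpow_one] at h3
  rw [h3, h2 f' hf' _ (by positivity)] at h1
  refine h1.trans ?_
  rw [add_left_comm]
  gcongr
  set x := P {ω | f' ω ∈ O}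
  have hpq : ((1 + lam) / lam).HolderConjugate (1 + lam) := by
    rw [Real.holderConjugate_iff]
    constructor
    · rw [lt_div_iff₀ hlam]; linarith
    · field_simp
      ring
  -- Young's inequality splits the product into `e^ε x` and `exp (G - lam ε)`; the factor `e^ε` is
  -- inserted in the first term and compensated in the second.
  have hy := ENNReal.young_inequality
    ((ENNReal.ofReal (Real.exp ε) * x) ^ (lam / (1 + lam)))
    (ENNReal.ofReal (Real.exp ((G - lam * ε) / (1 + lam)))) hpq
  calc _ = (ENNReal.ofReal (Real.exp ε) * x) ^ (lam / (1 + lam)) *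
        ENNReal.ofReal (Real.exp ((G - lam * ε) / (1 + lam))) := by
        rw [ENNReal.mul_rpow_of_nonneg _ _ (by positivity),
          ENNReal.ofReal_rpow_of_pos (Real.exp_pos _), ← Real.exp_mul, mul_right_comm,
          ← ENNReal.ofReal_mul (Real.exp_pos _).le, ← Real.exp_add]
        congr 4
        field_simp
        ring
    _ ≤ _ := hy
    _ ≤ _ := by
        rw [← ENNReal.rpow_mul, div_mul_div_cancel₀ (by positivity), div_self hlam.ne',
          ENNReal.rpow_one, ENNReal.ofReal_rpow_of_pos (Real.exp_pos _), ← Real.exp_mul,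
          div_mul_cancel₀ _ (by positivity)]
        refine add_le_add ?_ ?_
        · refine ENNReal.div_le_of_le_mul (le_mul_of_one_le_right' ?_)
          rw [ENNReal.one_le_ofReal, le_div_iff₀ hlam]
          linarith
        · refine ENNReal.div_le_of_le_mul (le_mul_of_one_le_right' ?_)
          rw [ENNReal.one_le_ofReal]
          linarith

end IsHoelderClose

/-! ### Resampling one index -/

/-- The expectation of a function of i.i.d. images is an expectation over the preimages. -/
theorem sum_prod_comp {α β R : Type*} [Fintype α] [Fintype β] [DecidableEq β] [CommSemiring R]
    {b : ℕ} (t : α → β) (W : α → R) (V : β → R) (hV : ∀ c, V c = ∑ a with t a = c, W a)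
    (F : (Fin b → β) → R) :
    ∑ y : Fin b → β, (∏ i, V (y i)) * F y = ∑ x : Fin b → α, (∏ i, W (x i)) * F (t ∘ x) := by
  classical
  rw [← Finset.sum_fiberwise (s := Finset.univ) (g := fun x : Fin b → α => t ∘ x)]
  refine Finset.sum_congr rfl fun y _ => ?_
  simp_rw [hV]
  rw [Finset.prod_univ_sum, Finset.sum_mul]
  refine Finset.sum_congr ?_ fun x hx => ?_
  · ext x
    simp [funext_iff]
  · rw [← (Finset.mem_filter.1 hx).2]

/-- Drawing an index uniformly is the same as drawing an index other than `j` uniformly, and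
replacing it with `j` with probability `1 / n`. -/
theorem sum_resample {n b : ℕ} (hn : 2 ≤ n) (j : Fin n) (F : (Fin b → Fin n) → ENNReal) :
    ∑ y : Fin b → Fin n, (∏ _i : Fin b, ENNReal.ofReal (1 / n)) * F y =
      ∑ x : Fin b → Fin n, (∏ i, ENNReal.ofReal (if x i = j then 0 else 1 / (n - 1))) *
        ∑ m : Fin b → Bool, (∏ i, ENNReal.ofReal (if m i then (1 / n : ℝ) else 1 - 1 / n)) *
          F fun i => if m i then j else x i := by
  have hn' : (2 : ℝ) ≤ n := by exact_mod_cast hn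
  have hn1 : (0 : ℝ) ≤ 1 / (n - 1) := by
    have : (0 : ℝ) < n - 1 := by linarith
    positivity
  have hn2 : (0 : ℝ) ≤ 1 - 1 / n := by
    rw [sub_nonneg, div_le_one (by linarith)]; linarith
  rw [sum_prod_comp (α := Fin n × Bool) (fun a => if a.2 then j else a.1)
    (fun a => ENNReal.ofReal (if a.1 = j then 0 else 1 / (n - 1)) *
      ENNReal.ofReal (if a.2 then (1 / n : ℝ) else 1 - 1 / n)) (fun _ => ENNReal.ofReal (1 / n))]
  · rw [← (Equiv.arrowProdEquivProdArrow (Fin b) (fun _ => Fin n) (fun _ => Bool)).symm.sum_comp,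
      Fintype.sum_prod_type]
    refine Finset.sum_congr rfl fun x _ => ?_
    rw [Finset.mul_sum]
    refine Finset.sum_congr rfl fun m _ => ?_
    rw [← mul_assoc, ← Finset.prod_mul_distrib]
    rfl
  · intro c
    rw [Finset.sum_filter, Fintype.sum_prod_type]
    simp only [Fintype.sum_bool, if_true, Bool.false_eq_true, if_false]
    rw [Finset.sum_add_distrib, Finset.sum_ite_eq' Finset.univ c, if_pos (Finset.mem_univ c)]
    -- The index `j` arises only by overwriting, with probability `1/n`; any other index has
    -- probability `(1/(n-1)) (1 - 1/n) = 1/n`.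
    by_cases hc : j = c
    · subst hc
      simp only [if_true, ENNReal.ofReal_zero, zero_mul, add_zero]
      rw [← Finset.sum_mul, ← ENNReal.ofReal_sum_of_nonneg fun i _ => by split_ifs; exacts [le_rfl, hn1],
        Finset.sum_ite, Finset.sum_const_zero, zero_add, Finset.sum_const]
      have : (Finset.univ.filter fun i => ¬ i = j).card = n - 1 := by
        rw [Finset.filter_not, Finset.filter_eq' , if_pos (Finset.mem_univ j)]
        simp [Finset.card_sdiff]
      rw [this, nsmul_eq_mul, Nat.cast_sub (by omega), Nat.cast_one, mul_one_div_cancel (by linarith)]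
      simp
    · simp only [if_neg hc, if_neg (Ne.symm hc), Finset.sum_const_zero, zero_add]
      rw [← ENNReal.ofReal_mul hn1]
      congr 1
      have : (n : ℝ) - 1 ≠ 0 := by linarith
      field_simp

instance isProbabilityMeasure_drawLaw {n b d : ℕ} [NeZero n] :
    IsProbabilityMeasure (drawLaw n b d) := by
  unfold drawLaw
  have : IsProbabilityMeasure (uniformOn (Set.univ : Set (Fin b → Fin n))) :=
    isProbabilityMeasure_uniformOn Set.finite_univ Set.univ_nonempty
  infer_instance

theorem lintegral_drawLaw {n b d : ℕ} [NeZero n] {f : Draw n b d → ENNReal} (hf : Measurable f) :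
    ∫⁻ ω, f ω ∂drawLaw n b d = ∑ y : Fin b → Fin n, (∏ _i : Fin b, ENNReal.ofReal (1 / n)) *
      ∫⁻ w, f (y, w) ∂stdGaussian (Vec d) := by
  have : IsProbabilityMeasure (uniformOn (Set.univ : Set (Fin b → Fin n))) :=
    isProbabilityMeasure_uniformOn Set.finite_univ Set.univ_nonempty
  rw [drawLaw, lintegral_prod _ hf.aemeasurable, lintegral_fintype]
  refine Finset.sum_congr rfl fun y _ => ?_
  rw [mul_comm]
  congr 1
  have hn : (0 : ℝ) < n := by exact_mod_cast Nat.pos_of_ne_zero (NeZero.ne n)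
  rw [uniformOn_univ, Measure.count_singleton, Finset.prod_const, Finset.card_univ,
    Fintype.card_fin, Fintype.card_fun, Fintype.card_fin, Fintype.card_fin, one_div, one_div,
    ENNReal.ofReal_inv_of_pos hn, ENNReal.ofReal_natCast, ← ENNReal.inv_pow]
  push_cast
  rfl

/-- The weight of the set of batch positions at which a given index is drawn. -/
def maskWeight (n : ℕ) {b : ℕ} (m : Fin b → Bool) : ℝ :=
  ∏ i, if m i then (1 / n : ℝ) else 1 - 1 / n

/-- The number of batch positions at which a given index is drawn. -/
def maskCard {b : ℕ} (m : Fin b → Bool) : ℕ := (Finset.univ.filter fun i => m i = true).card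

/-- A mask with `k` hits has weight at most `(1/n)^k = (1/(2b))^k (2b/n)^k`. The first factor is the
majorant: over all masks it sums to `(1 + 1/(2b))^b ≤ √e ≤ 2`, and removing the empty mask leaves at
most 1. -/
theorem isRareMixture_mask {n b d : ℕ} (hn : 2 ≤ n) (hb : 1 ≤ b) {s : ℝ} (e : Fin b → Vec d)
    (he : ∀ i, ‖e i‖ ≤ 2 / s) :
    IsRareMixture (√(2 * b / n)) s (maskWeight n)
      (fun m : Fin b → Bool => if maskCard m = 0 then 0 else (1 / (2 * b : ℝ)) ^ maskCard m)
      maskCard (fun m => ∑ i, if m i then e i else 0) := by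
  have hn' : (2 : ℝ) ≤ n := by exact_mod_cast hn
  have hb' : (1 : ℝ) ≤ b := by exact_mod_cast hb
  have hn1 : (0 : ℝ) ≤ 1 - 1 / n := by
    rw [sub_nonneg, div_le_one (by linarith)]; linarith
  have hprod : ∀ (x y : ℝ), ∑ m : Fin b → Bool, ∏ i, (if m i then x else y) = (x + y) ^ b := by
    intro x y
    have := Finset.prod_univ_sum (fun _ : Fin b => (Finset.univ : Finset Bool))
      fun _ β => if β then x else y
    rw [Fintype.piFinset_univ] at this
    rw [← this]
    simp
  have hle : ∀ (x y : ℝ), 0 ≤ x → 0 ≤ y → y ≤ 1 → ∀ m : Fin b → Bool,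
      (∏ i, if m i then x else y) ≤ x ^ maskCard m := by
    intro x y hx hy hy1 m
    rw [Finset.prod_ite, Finset.prod_const, Finset.prod_const, maskCard]
    exact mul_le_of_le_one_right (by positivity) (pow_le_one₀ hy hy1)
  have hpow : ∀ m : Fin b → Bool, (1 / (2 * b : ℝ)) ^ maskCard m =
      ∏ i, if m i then (1 / (2 * b : ℝ)) else 1 := by
    intro m
    rw [Finset.prod_ite, Finset.prod_const, Finset.prod_const_one, mul_one, maskCard]
  refine ⟨fun m => ?_, ?_, fun m => ?_, ?_, fun m hm => ?_, fun m => ?_⟩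
  · exact Finset.prod_nonneg fun i _ => by split_ifs; exacts [by positivity, hn1]
  · unfold maskWeight
    rw [hprod]
    simp
  · split_ifs
    · exact le_rfl
    · positivity
  · have h1 : ∑ m : Fin b → Bool,
          (if maskCard m = 0 then 0 else (1 / (2 * b : ℝ)) ^ maskCard m) + 1 ≤
        ∑ m : Fin b → Bool, (1 / (2 * b : ℝ)) ^ maskCard m := by
      rw [← Finset.add_sum_erase _ _ (Finset.mem_univ fun _ => false),
        ← Finset.add_sum_erase (a := fun _ : Fin b => false) _
          (fun m => (1 / (2 * b : ℝ)) ^ maskCard m) (Finset.mem_univ _)]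
      have h2 : maskCard (fun _ : Fin b => false) = 0 := by simp [maskCard]
      rw [h2, if_pos rfl, pow_zero, zero_add, add_comm]
      gcongr with m _
      split_ifs
      · positivity
      · exact le_rfl
    have h3 : ∑ m : Fin b → Bool, (1 / (2 * b : ℝ)) ^ maskCard m ≤ 2 := by
      simp_rw [hpow]
      rw [hprod]
      calc (1 / (2 * b : ℝ) + 1) ^ b ≤ Real.exp (1 / (2 * b)) ^ b := by
            gcongr
            exact Real.add_one_le_exp _
        _ = Real.exp (1 / 2) := by
            rw [← Real.exp_nat_mul]
            congr 1
            field_simp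
        _ ≤ 2 := by
            have h4 : Real.exp (1 / 2) ^ 2 = Real.exp 1 := by rw [← Real.exp_nat_mul]; norm_num
            have := Real.exp_one_lt_d9
            nlinarith [Real.exp_pos (1 / 2)]
    linarith
  · rw [if_neg hm, Real.sq_sqrt (by positivity), ← mul_pow]
    have h5 : 1 / (2 * b : ℝ) * (2 * b / n) = 1 / n := by field_simp
    rw [h5]
    refine hle _ _ (by positivity) hn1 ?_ m
    rw [sub_le_self_iff]
    positivity
  · calc ‖∑ i, if m i then e i else 0‖ ≤ ∑ i, if m i then 2 / s else 0 := by
          refine (norm_sum_le _ _).trans (Finset.sum_le_sum fun i _ => ?_)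
          split_ifs
          · exact he i
          · simp
      _ = 2 / s * maskCard m := by
          rw [← Finset.sum_filter, Finset.sum_const, nsmul_eq_mul, mul_comm, maskCard]

/-- A subsampled Gaussian mechanism: the mean over the batch of the vectors `c i (ω.1 i)`, plus
Gaussian noise. -/
def noisyMean {n b d : ℕ} (R : Vec d →L[ℝ] Vec d) (s : ℝ) (c : Fin b → Fin n → Vec d)
    (ω : Draw n b d) : Vec d :=
  (1 / (b : ℝ)) • ∑ i, c i (ω.1 i) + (s / b) • R ω.2

theorem measurable_noisyMean {n b d : ℕ} (R : Vec d →L[ℝ] Vec d) (s : ℝ)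
    (c : Fin b → Fin n → Vec d) : Measurable (noisyMean R s c) := by
  unfold noisyMean
  refine Measurable.add ?_ (by fun_prop)
  exact (measurable_of_countable fun y : Fin b → Fin n =>
    (1 / (b : ℝ)) • ∑ i, c i (y i)).comp measurable_fst

/-- Condition on the indices `x` drawn before overwriting. They avoid `j`, so `c` and `c'` agree on
them and, up to a common translation, both outputs are rare mixtures with identical weights. The
conditional Hölder inequalities are then averaged over `x`. -/
theorem isHoelderClose_noisyMean {n b d : ℕ} (hn : 2 ≤ n) (hb : 1 ≤ b) {s lam : ℝ} (hs : 1 ≤ s)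
    (hlam : 1 ≤ lam) (hσ1 : Real.log (√(2 * b / n)) ≤ -33)
    (hlamσ : 32 * (lam * (2 / s) ^ 2 * √(2 * b / n)) ≤ 1)
    {R Ri : Vec d →L[ℝ] Vec d} (hR : ∀ v, R (Ri v) = v) {c c' : Fin b → Fin n → Vec d}
    (hc : ∀ i a, ‖Ri (c i a)‖ ≤ 1) (hc' : ∀ i a, ‖Ri (c' i a)‖ ≤ 1) {j : Fin n}
    (hj : ∀ i a, a ≠ j → c i a = c' i a) :
    IsHoelderClose lam (√(2 * b / n) ^ 4 * Real.exp (-s ^ 2))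
      (lam * (√(2 * b / n) ^ 4 * Real.exp (-s ^ 2)) +
        renyiConst * (lam * √(2 * b / n) ^ 2 * (2 / s)) ^ 2)
      (drawLaw n b d) (noisyMean R s c) (noisyMean R s c') := by
  intro φ hφ hφ1
  have hn' : (2 : ℝ) ≤ n := by exact_mod_cast hn
  have hb' : (1 : ℝ) ≤ b := by exact_mod_cast hb
  have hs0 : 0 < s := by linarith
  have hlam0 : 0 < lam := by linarith
  have : NeZero n := ⟨by omega⟩
  set τ := √(2 * b / n) ^ 4 * Real.exp (-s ^ 2)
  set G := lam * τ + renyiConst * (lam * √(2 * b / n) ^ 2 * (2 / s)) ^ 2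
  set r := (1 + lam) / lam with hr
  set q := lam / (1 + lam) with hq
  set U : (Fin b → Fin n) → ENNReal := fun x =>
    ∏ i, ENNReal.ofReal (if x i = j then 0 else 1 / (n - 1)) with hU
  have hp : ∀ m : Fin b → Bool, (∏ i, ENNReal.ofReal (if m i then (1 / n : ℝ) else 1 - 1 / n)) =
      ENNReal.ofReal (maskWeight n m) := by
    intro m
    rw [maskWeight, ENNReal.ofReal_prod_of_nonneg]
    intro i _
    split_ifs
    · positivity
    · rw [sub_nonneg, div_le_one (by linarith)]; linarith
  -- The resampling identity for the constant function 1, with the mask weights summing to one.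
  have hU1 : ∑ x, U x = 1 := by
    have h := sum_resample (b := b) hn j fun _ => 1
    have H := isRareMixture_mask (d := d) hn hb (s := s) (fun _ => 0) fun _ => by
      rw [norm_zero]; positivity
    have hm : ∑ m : Fin b → Bool, ENNReal.ofReal (maskWeight n m) = 1 := by
      rw [← ENNReal.ofReal_sum_of_nonneg fun m _ => H.nonneg m, H.sum_eq_one, ENNReal.ofReal_one]
    simp only [mul_one, hp, hm] at h
    rw [hU, ← h, Finset.sum_const, Finset.prod_const, Finset.card_univ, Finset.card_univ,
      Fintype.card_fun, Fintype.card_fin, Fintype.card_fin, nsmul_eq_mul, ← ENNReal.ofReal_pow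
      (by positivity), ← ENNReal.ofReal_natCast, ← ENNReal.ofReal_mul (by positivity)]
    push_cast
    rw [← mul_pow, mul_one_div_cancel (by linarith)]
    simp
  have hdraw : ∀ (c : Fin b → Fin n → Vec d) (f : Vec d → ENNReal), Measurable f →
      ∫⁻ ω, f (noisyMean R s c ω) ∂drawLaw n b d = ∑ x, U x * ∑ m : Fin b → Bool,
        ENNReal.ofReal (maskWeight n m) *
          ∫⁻ w, f (noisyMean R s c (fun i => if m i then j else x i, w)) ∂stdGaussian (Vec d) := by
    intro c f hf
    rw [lintegral_drawLaw (f := fun ω => f (noisyMean R s c ω))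
      (hf.comp (measurable_noisyMean R s c)), sum_resample hn j]
    simp_rw [hp]
    rfl
  have hshift : ∀ (c c' : Fin b → Fin n → Vec d) (x : Fin b → Fin n) (m : Fin b → Bool)
      (w : Vec d), (∀ i, c' i (x i) = c i (x i)) →
      noisyMean R s c' (fun i => if m i then j else x i, w) =
      (1 / (b : ℝ)) • ∑ i, c i (x i) + (s / b) • R (w + ∑ i, if m i then
        s⁻¹ • Ri (c' i j - c i (x i)) else 0) := by
    intro c c' x m w hx
    have h1 : R (∑ i, if m i then s⁻¹ • Ri (c' i j - c i (x i)) else 0) =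
        s⁻¹ • ∑ i, if m i then c' i j - c i (x i) else 0 := by
      rw [map_sum, Finset.smul_sum]
      refine Finset.sum_congr rfl fun i _ => ?_
      split_ifs
      · rw [map_smul, hR]
      · simp
    have h2 : (s / b) * s⁻¹ = 1 / (b : ℝ) := by field_simp
    rw [noisyMean, map_add, h1, smul_add, smul_smul, h2, add_comm ((s / b) • R w), ← add_assoc,
      ← smul_add, ← Finset.sum_add_distrib]
    congr 2
    refine Finset.sum_congr rfl fun i _ => ?_
    dsimp only
    split_ifs
    · rw [add_sub_cancel]
    · rw [add_zero, hx]
  have hmain : ∀ x, U x * ∑ m : Fin b → Bool, ENNReal.ofReal (maskWeight n m) *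
        ∫⁻ w, φ (noisyMean R s c (fun i => if m i then j else x i, w)) ∂stdGaussian (Vec d) ≤
      U x * (ENNReal.ofReal τ + ENNReal.ofReal (Real.exp (G / (1 + lam))) *
        (∑ m : Fin b → Bool, ENNReal.ofReal (maskWeight n m) *
        ∫⁻ w, φ (noisyMean R s c' (fun i => if m i then j else x i, w)) ^ r
          ∂stdGaussian (Vec d)) ^ q) := by
    intro x
    by_cases hx : ∃ i, x i = j
    · obtain ⟨i, hi⟩ := hx
      have : U x = 0 := Finset.prod_eq_zero (Finset.mem_univ i) (by simp [hi])
      simp [this]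
    · push Not at hx
      gcongr
      have he : ∀ c' : Fin b → Fin n → Vec d, (∀ i a, ‖Ri (c' i a)‖ ≤ 1) →
          ∀ i, ‖s⁻¹ • Ri (c' i j - c i (x i))‖ ≤ 2 / s := by
        intro c' hc' i
        rw [norm_smul, norm_inv, Real.norm_of_nonneg hs0.le, map_sub, div_eq_inv_mul]
        gcongr
        refine (norm_sub_le _ _).trans ?_
        linarith [hc' i j, hc i (x i)]
      have h := sum_lintegral_le_rpow (isRareMixture_mask hn hb _ (he c hc))
        (isRareMixture_mask hn hb _ (he c' hc'))
        (Real.sqrt_pos.2 (by positivity)) hσ1 hs hlam hlamσ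
        (φ := fun w => φ ((1 / (b : ℝ)) • ∑ i, c i (x i) + (s / b) • R w)) (by fun_prop)
        fun w => hφ1 _
      simp_rw [hshift c c x _ _ fun _ => rfl, hshift c c' x _ _ fun i => (hj i _ (hx i)).symm]
      exact h
  rw [hdraw c φ hφ, hdraw c' (fun v => φ v ^ r) (by fun_prop)]
  refine (Finset.sum_le_sum fun x _ => hmain x).trans ?_
  simp_rw [mul_add, ← mul_left_comm (ENNReal.ofReal (Real.exp (G / (1 + lam))))]
  rw [Finset.sum_add_distrib, ← Finset.sum_mul, hU1, one_mul, ← Finset.mul_sum]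
  gcongr
  set Q : (Fin b → Fin n) → ENNReal := fun x => ∑ m : Fin b → Bool,
    ENNReal.ofReal (maskWeight n m) *
      ∫⁻ w, φ (noisyMean R s c' (fun i => if m i then j else x i, w)) ^ r ∂stdGaussian (Vec d)
  have hr1 : 1 ≤ r := by rw [hr, le_div_iff₀ hlam0]; linarith
  have hqr : q * r = 1 := by rw [hr, hq]; field_simp
  have hq0 : 0 ≤ q := by positivity
  -- The power `q ≤ 1` is concave, so the average of the conditional `q`-th powers is at most the
  -- `q`-th power of the average.
  have hjensen := ENNReal.rpow_arith_mean_le_arith_mean_rpow Finset.univ U (fun x => Q x ^ q) hU1 hr1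
  simp_rw [← ENNReal.rpow_mul, hqr, ENNReal.rpow_one] at hjensen
  calc _ = ((∑ x, U x * Q x ^ q) ^ r) ^ q := by
        rw [← ENNReal.rpow_mul, mul_comm r q, hqr, ENNReal.rpow_one]
    _ ≤ _ := by gcongr

/-! ### Measurability of matrix operations -/

section Matrix

variable {d : ℕ} {Y : Type*} [MeasurableSpace Y]

theorem posSemidef_sqrt (A : Matrix (Fin d) (Fin d) ℝ) : (CFC.sqrt A).PosSemidef :=
  Matrix.nonneg_iff_posSemidef.1 (CFC.sqrt_nonneg A)

theorem measurable_matrix_inv {M : Y → Matrix (Fin d) (Fin d) ℝ}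
    (hM : ∀ p q, Measurable fun y => M y p q) (p q : Fin d) :
    Measurable fun y => (M y)⁻¹ p q := by
  have hpi : Measurable fun y => (fun p q => M y p q : Fin d → Fin d → ℝ) :=
    measurable_pi_lambda _ fun p => measurable_pi_lambda _ fun q => hM p q
  have hof : Continuous fun B : Fin d → Fin d → ℝ => Matrix.of B := continuous_id
  have hdet' : Continuous fun B : Fin d → Fin d → ℝ => (Matrix.of B).det := hof.matrix_det
  have hadj' : Continuous fun B : Fin d → Fin d → ℝ => (Matrix.of B).adjugate p q :=
    hof.matrix_adjugate.matrix_elem p q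
  have hdet : Measurable fun y => (M y).det := hdet'.measurable.comp hpi
  have hadj : Measurable fun y => (M y).adjugate p q := hadj'.measurable.comp hpi
  simp only [Matrix.inv_def, Ring.inverse_eq_inv', Matrix.smul_apply, smul_eq_mul]
  exact hdet.inv.mul hadj

theorem isClosed_setOf_posSemidef :
    IsClosed {B : Fin d → Fin d → ℝ | (Matrix.of B).PosSemidef} := by
  simp only [Matrix.posSemidef_iff_dotProduct_mulVec, Set.ofPred_and, Set.ofPred_forall]
  refine IsClosed.inter ?_ (isClosed_iInter fun x => ?_)
  · simp only [Matrix.IsHermitian, ← Matrix.ext_iff, Set.ofPred_forall]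
    refine isClosed_iInter fun p => isClosed_iInter fun q => ?_
    simp only [Matrix.conjTranspose_apply, Matrix.of_apply]
    exact isClosed_eq (by fun_prop) (by fun_prop)
  · refine isClosed_le continuous_const ?_
    simp only [dotProduct, Matrix.mulVec, Matrix.of_apply]
    fun_prop

/-- Squaring is continuous and injective on the closed set of positive semidefinite matrices, hence
a measurable embedding by Lusin–Souslin; the square root is its inverse. -/
theorem measurable_matrix_sqrt {M : Y → Matrix (Fin d) (Fin d) ℝ}
    (hM : ∀ p q, Measurable fun y => M y p q) (hpos : ∀ y, (M y).PosSemidef) (p q : Fin d) :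
    Measurable fun y => CFC.sqrt (M y) p q := by
  set t : Set (Fin d → Fin d → ℝ) := {B | (Matrix.of B).PosSemidef} with ht
  set f : (Fin d → Fin d → ℝ) → (Fin d → Fin d → ℝ) := fun B => Matrix.of.symm
    (Matrix.of B * Matrix.of B) with hf
  have hcont : Continuous f := by
    refine continuous_pi fun p => continuous_pi fun q => ?_
    simp only [hf, Matrix.of_symm_apply, Matrix.mul_apply, Matrix.of_apply]
    fun_prop
  have hinj : Set.InjOn f t := by
    intro B hB B' hB' h
    have h1 : Matrix.of B * Matrix.of B = Matrix.of B' * Matrix.of B' := h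
    have h2 := CFC.sqrt_mul_self (Matrix.of B) (Matrix.PosSemidef.nonneg hB)
    rw [h1, CFC.sqrt_mul_self _ (Matrix.PosSemidef.nonneg hB')] at h2
    exact h2.symm
  have hemb := ContinuousOn.measurableEmbedding isClosed_setOf_posSemidef.measurableSet
    hcont.continuousOn hinj
  have hsqrt : Measurable fun y => (⟨Matrix.of.symm (CFC.sqrt (M y)),
      posSemidef_sqrt (M y)⟩ : t) := by
    rw [← hemb.measurable_comp_iff]
    have : (t.domRestrict f ∘ fun y => (⟨Matrix.of.symm (CFC.sqrt (M y)),
        posSemidef_sqrt (M y)⟩ : t)) = fun y p q => M y p q := by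
      ext y p q
      exact congrFun (congrFun (CFC.sqrt_mul_sqrt_self (M y) (hpos y).nonneg) p) q
    rw [this]
    exact measurable_pi_lambda _ fun p => measurable_pi_lambda _ fun q => hM p q
  exact (measurable_pi_apply q).comp ((measurable_pi_apply p).comp
    (measurable_subtype_coe.comp hsqrt))

theorem measurable_toEuclideanCLM_apply {M : Y → Matrix (Fin d) (Fin d) ℝ}
    (hM : ∀ p q, Measurable fun y => M y p q) {f : Y → Vec d} (hf : Measurable f) :
    Measurable fun y => Matrix.toEuclideanCLM (𝕜 := ℝ) (M y) (f y) := by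
  have : (fun y => Matrix.toEuclideanCLM (𝕜 := ℝ) (M y) (f y)) =
      fun y => WithLp.toLp 2 fun p => ∑ q, M y p q * f y q := by
    ext y p
    simp [Matrix.ofLp_toEuclideanCLM, Matrix.mulVec, dotProduct]
  rw [this]
  refine (by fun_prop : Measurable (WithLp.toLp 2 : (Fin d → ℝ) → Vec d)).comp
    (measurable_pi_lambda _ fun p => Finset.measurable_sum _ fun q _ => (hM p q).mul ?_)
  fun_prop

theorem mahalanobis_eq_norm {A : Matrix (Fin d) (Fin d) ℝ} (hA : A.PosSemidef) (x : Vec d) :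
    mahalanobis A x = ‖Matrix.toEuclideanCLM (𝕜 := ℝ) (CFC.sqrt A) x‖ := by
  rw [mahalanobis, EuclideanSpace.norm_eq]
  congr 1
  have hS : (CFC.sqrt A).transpose = CFC.sqrt A := by
    simpa [Matrix.IsHermitian] using (posSemidef_sqrt A).1
  have h1 : A.mulVec x.ofLp = (CFC.sqrt A).mulVec ((CFC.sqrt A).mulVec x.ofLp) := by
    rw [Matrix.mulVec_mulVec, CFC.sqrt_mul_sqrt_self A hA.nonneg]
  rw [h1, Matrix.dotProduct_mulVec, ← Matrix.mulVec_transpose, hS, dotProduct]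
  refine Finset.sum_congr rfl fun i _ => ?_
  rw [Matrix.ofLp_toEuclideanCLM, Real.norm_eq_abs, sq_abs, sq]

theorem sqrt_inv_mul_sqrt {A : Matrix (Fin d) (Fin d) ℝ} (hA : A.PosDef) :
    CFC.sqrt A⁻¹ * CFC.sqrt A = 1 := by
  rw [← hA.posSemidef.inv_sqrt]
  refine Matrix.nonsing_inv_mul _ ?_
  have h := CFC.sqrt_mul_sqrt_self A hA.posSemidef.nonneg
  have h2 : (CFC.sqrt A).det * (CFC.sqrt A).det = A.det := by rw [← Matrix.det_mul, h]
  have := hA.det_pos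
  rw [isUnit_iff_ne_zero]
  rintro h0
  rw [h0, mul_zero] at h2
  linarith

theorem toEuclideanCLM_sqrt_inv_apply {A : Matrix (Fin d) (Fin d) ℝ} (hA : A.PosDef) (v : Vec d) :
    Matrix.toEuclideanCLM (𝕜 := ℝ) (CFC.sqrt A⁻¹)
      (Matrix.toEuclideanCLM (𝕜 := ℝ) (CFC.sqrt A) v) = v := by
  change (Matrix.toEuclideanCLM (𝕜 := ℝ) (CFC.sqrt A⁻¹) *
    Matrix.toEuclideanCLM (𝕜 := ℝ) (CFC.sqrt A)) v = v
  rw [← map_mul, sqrt_inv_mul_sqrt hA, map_one]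
  rfl

theorem toEuclideanCLM_sqrt_apply {A : Matrix (Fin d) (Fin d) ℝ} (hA : A.PosDef) (v : Vec d) :
    Matrix.toEuclideanCLM (𝕜 := ℝ) (CFC.sqrt A)
      (Matrix.toEuclideanCLM (𝕜 := ℝ) (CFC.sqrt A⁻¹) v) = v := by
  change (Matrix.toEuclideanCLM (𝕜 := ℝ) (CFC.sqrt A) *
    Matrix.toEuclideanCLM (𝕜 := ℝ) (CFC.sqrt A⁻¹)) v = v
  rw [← map_mul, mul_eq_one_comm.1 (sqrt_inv_mul_sqrt hA), map_one]
  rfl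

end Matrix

/-! ### Measurability of projections -/

section Argmin

variable {d : ℕ} {Y : Type*} [MeasurableSpace Y] {C : Set (Vec d)}

theorem exists_isMin_norm {L : Vec d →L[ℝ] Vec d} (hL : Function.Injective L) (hC : IsClosed C)
    (hne : C.Nonempty) (w : Vec d) : ∃ v ∈ C, ∀ v' ∈ C, ‖L v - w‖ ≤ ‖L v' - w‖ := by
  have hemb : Topology.IsClosedEmbedding L :=
    LinearMap.isClosedEmbedding_of_injective (f := (L : Vec d →ₗ[ℝ] Vec d))
      (LinearMap.ker_eq_bot.2 hL)
  obtain ⟨_, ⟨v, hv, rfl⟩, h⟩ :=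
    (hemb.isClosedMap _ hC).exists_infDist_eq_dist (hne.image L) w
  refine ⟨v, hv, fun v' hv' => ?_⟩
  rw [← dist_eq_norm, ← dist_eq_norm, dist_comm, ← h, dist_comm]
  exact Metric.infDist_le_dist_of_mem (Set.mem_image_of_mem L hv')

/-- By the parallelogram law the midpoint of two distinct minimizers would be strictly better. -/
theorem eq_of_isMin_norm {L : Vec d →L[ℝ] Vec d} (hL : Function.Injective L) (hC : Convex ℝ C)
    {w v v' : Vec d} (hv : v ∈ C) (hv' : v' ∈ C) (hmin : ∀ u ∈ C, ‖L v - w‖ ≤ ‖L u - w‖)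
    (hle : ‖L v' - w‖ ≤ ‖L v - w‖) : v' = v := by
  apply hL
  have hmid := hmin _ (hC hv hv' (by norm_num : (0 : ℝ) ≤ 1 / 2) (by norm_num : (0 : ℝ) ≤ 1 / 2)
    (by norm_num))
  have hpar := parallelogram_law_with_norm ℝ (L v - w) (L v' - w)
  have h1 : L ((1 / 2 : ℝ) • v + (1 / 2 : ℝ) • v') - w =
      (1 / 2 : ℝ) • ((L v - w) + (L v' - w)) := by
    rw [map_add, map_smul, map_smul]
    module
  rw [h1, norm_smul, Real.norm_of_nonneg (by norm_num)] at hmid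
  have h2 : ‖(L v - w) - (L v' - w)‖ = 0 := by
    have h3 := norm_nonneg ((L v - w) - (L v' - w))
    nlinarith [norm_nonneg (L v - w), norm_nonneg (L v' - w), norm_nonneg ((L v - w) + (L v' - w))]
  have h4 := norm_eq_zero.1 h2
  rw [sub_sub_sub_cancel_right, sub_eq_zero] at h4
  exact h4.symm

theorem argminOn_spec {L : Vec d →L[ℝ] Vec d} (hL : Function.Injective L) (hC : IsClosed C)
    (hne : C.Nonempty) (w : Vec d) {φ : Vec d → ℝ} (hφ : ∀ v, φ v = ‖L v - w‖) :
    argminOn C φ ∈ C ∧ ∀ v' ∈ C, φ (argminOn C φ) ≤ φ v' := by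
  obtain ⟨v, hv⟩ := exists_isMin_norm hL hC hne w
  simp_rw [← hφ] at hv
  exact Classical.epsilon_spec (p := fun y => y ∈ C ∧ ∀ y' ∈ C, φ y ≤ φ y') ⟨v, hv⟩

/-- By uniqueness, the minimizer lies in a closed set `K` exactly when the infimum over `K ∩ C` does
not exceed the infimum over `C`. Both infima can be taken over fixed countable dense sequences,
which makes this a countable combination of measurable conditions. -/
theorem measurable_of_isMin_norm (hC : IsClosed C) (hconv : Convex ℝ C)
    {L : Y → Vec d →L[ℝ] Vec d} (hL : ∀ y, Function.Injective (L y))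
    (hLm : ∀ v, Measurable fun y => L y v) {w : Y → Vec d} (hw : Measurable w) {m : Y → Vec d}
    (hm : ∀ y, m y ∈ C) (hmin : ∀ y, ∀ v ∈ C, ‖L y (m y) - w y‖ ≤ ‖L y v - w y‖) :
    Measurable m := by
  refine measurable_of_isClosed fun K hK => ?_
  rcases (K ∩ C).eq_empty_or_nonempty with hemp | hne
  · have : m ⁻¹' K = ∅ := by
      ext y
      simp only [Set.mem_preimage, Set.mem_empty_iff_false, iff_false]
      intro hy
      have h : m y ∈ K ∩ C := ⟨hy, hm y⟩
      rw [hemp] at h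
      exact h
    rw [this]
    exact MeasurableSet.empty
  have : Nonempty C := ⟨⟨_, hne.some_mem.2⟩⟩
  have : Nonempty ↑(K ∩ C) := hne.to_subtype
  set cC := fun i => (TopologicalSpace.denseSeq C i : Vec d) with hcC
  set cK := fun i => (TopologicalSpace.denseSeq ↑(K ∩ C) i : Vec d) with hcK
  have happrox : ∀ (D : Set (Vec d)) [Nonempty D] (y : Y) (v : Vec d), v ∈ D → ∀ r : ℝ,
      ‖L y v - w y‖ < r → ∃ i, ‖L y (TopologicalSpace.denseSeq D i : Vec d) - w y‖ < r := by
    intro D _ y v hv r hr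
    have hopen : IsOpen {x : D | ‖L y x - w y‖ < r} :=
      isOpen_lt (by fun_prop) continuous_const
    obtain ⟨_, hx, ⟨i, rfl⟩⟩ :=
      (TopologicalSpace.denseRange_denseSeq D).inter_open_nonempty _ hopen ⟨⟨v, hv⟩, hr⟩
    exact ⟨i, hx⟩
  have hset : m ⁻¹' K = ⋂ i : ℕ, ⋂ N : ℕ, ⋃ j : ℕ,
      {y | ‖L y (cK j) - w y‖ < ‖L y (cC i) - w y‖ + 1 / ((N : ℝ) + 1)} := by
    ext y
    simp only [Set.mem_preimage, Set.mem_iInter, Set.mem_iUnion, Set.mem_ofPred_eq]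
    constructor
    · intro hy i N
      have hN : (0 : ℝ) < 1 / ((N : ℝ) + 1) := by positivity
      exact happrox (K ∩ C) y (m y) ⟨hy, hm y⟩ _
        (by linarith [hmin y (cC i) (TopologicalSpace.denseSeq C i).2])
    · intro h
      obtain ⟨v, hv, hvmin⟩ := exists_isMin_norm (hL y) (hK.inter hC) hne (w y)
      have h1 : ∀ i, ‖L y v - w y‖ ≤ ‖L y (cC i) - w y‖ := by
        intro i
        refine le_of_forall_pos_lt_add fun η hη => ?_
        obtain ⟨N, hN⟩ := exists_nat_one_div_lt hη
        obtain ⟨j, hj⟩ := h i N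
        have := hvmin (cK j) (TopologicalSpace.denseSeq ↑(K ∩ C) j).2
        linarith
      have h2 : ‖L y v - w y‖ ≤ ‖L y (m y) - w y‖ := by
        by_contra! hlt
        obtain ⟨i, hi⟩ := happrox C y (m y) (hm y) _ hlt
        exact absurd (h1 i) (not_le.2 hi)
      rw [← eq_of_isMin_norm (hL y) hconv (hm y) hv.2 (hmin y) h2]
      exact hv.1
  rw [hset]
  refine MeasurableSet.iInter fun i => MeasurableSet.iInter fun N => MeasurableSet.iUnion fun j => ?_
  have h1 := hLm (cK j)
  have h2 := hLm (cC i)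
  exact measurableSet_lt (by fun_prop) (by fun_prop)

theorem measurable_proj (hC : IsClosed C) (hconv : Convex ℝ C) (hne : C.Nonempty)
    {w : Y → Vec d} (hw : Measurable w) : Measurable fun y => proj C (w y) := by
  have hspec := fun y => argminOn_spec (L := ContinuousLinearMap.id ℝ (Vec d))
    Function.injective_id hC hne (w y) (φ := fun v => ‖v - w y‖) fun v => rfl
  exact measurable_of_isMin_norm hC hconv (L := fun _ => ContinuousLinearMap.id ℝ (Vec d))
    (fun _ => Function.injective_id) (fun v => measurable_const) hw
    (fun y => (hspec y).1) fun y => (hspec y).2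

theorem injective_toEuclideanCLM_sqrt {A : Matrix (Fin d) (Fin d) ℝ} (hA : A.PosDef) :
    Function.Injective (Matrix.toEuclideanCLM (𝕜 := ℝ) (CFC.sqrt A)) :=
  Function.LeftInverse.injective (toEuclideanCLM_sqrt_inv_apply hA)

theorem measurable_projWrt (hC : IsClosed C) (hconv : Convex ℝ C) (hne : C.Nonempty)
    {H : Y → Matrix (Fin d) (Fin d) ℝ} (hH : ∀ p q, Measurable fun y => H y p q)
    (hpos : ∀ y, (H y).PosDef) {w : Y → Vec d} (hw : Measurable w) :
    Measurable fun y => projWrt (H y) C (w y) := by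
  have hS := measurable_matrix_sqrt hH fun y => (hpos y).posSemidef
  have hspec := fun y => argminOn_spec (injective_toEuclideanCLM_sqrt (hpos y)) hC hne
    (Matrix.toEuclideanCLM (𝕜 := ℝ) (CFC.sqrt (H y)) (w y))
    (φ := fun v => mahalanobis (H y) (v - w y)) fun v => by
      rw [mahalanobis_eq_norm (hpos y).posSemidef, map_sub]
  refine measurable_of_isMin_norm hC hconv
    (L := fun y => Matrix.toEuclideanCLM (𝕜 := ℝ) (CFC.sqrt (H y)))
    (fun y => injective_toEuclideanCLM_sqrt (hpos y))
    (fun v => measurable_toEuclideanCLM_apply hS measurable_const)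
    (measurable_toEuclideanCLM_apply hS hw) (fun y => (hspec y).1) fun y v hv => ?_
  rw [← map_sub, ← map_sub, ← mahalanobis_eq_norm (hpos y).posSemidef,
    ← mahalanobis_eq_norm (hpos y).posSemidef]
  exact (hspec y).2 v hv

theorem ellipsoid_eq {A : Matrix (Fin d) (Fin d) ℝ} (hA : A.PosDef) :
    ellipsoid A = Matrix.toEuclideanCLM (𝕜 := ℝ) (CFC.sqrt A) ⁻¹' Metric.closedBall 0 1 := by
  ext x
  simp [ellipsoid, mahalanobis_eq_norm hA.posSemidef]

theorem proj_ellipsoid_spec {A : Matrix (Fin d) (Fin d) ℝ} (hA : A.PosDef) (v : Vec d) :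
    proj (ellipsoid A) v ∈ ellipsoid A ∧
      ∀ v' ∈ ellipsoid A, ‖proj (ellipsoid A) v - v‖ ≤ ‖v' - v‖ :=
  argminOn_spec (L := ContinuousLinearMap.id ℝ (Vec d)) Function.injective_id
    (by rw [ellipsoid_eq hA]; exact Metric.isClosed_closedBall.preimage (by fun_prop))
    ⟨0, by simp [ellipsoid_eq hA]⟩ v (φ := fun y => ‖y - v‖) fun _ => rfl

/-- The ellipsoid varies with `y`. The substitution `u = A^{1/2} v` turns it into the fixed unit
ball and moves the dependence on `y` into the objective `‖A^{-1/2} u - w‖`, to which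
`measurable_of_isMin_norm` applies. -/
theorem measurable_proj_ellipsoid {A : Y → Matrix (Fin d) (Fin d) ℝ}
    (hA : ∀ p q, Measurable fun y => A y p q) (hpos : ∀ y, (A y).PosDef) {w : Y → Vec d}
    (hw : Measurable w) : Measurable fun y => proj (ellipsoid (A y)) (w y) := by
  have hR := measurable_matrix_sqrt (measurable_matrix_inv hA) fun y => (hpos y).inv.posSemidef
  have hm : Measurable fun y => Matrix.toEuclideanCLM (𝕜 := ℝ) (CFC.sqrt (A y))
      (proj (ellipsoid (A y)) (w y)) := by
    refine measurable_of_isMin_norm (C := Metric.closedBall 0 1) Metric.isClosed_closedBall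
      (convex_closedBall _ _) (L := fun y => Matrix.toEuclideanCLM (𝕜 := ℝ) (CFC.sqrt (A y)⁻¹))
      (fun y => injective_toEuclideanCLM_sqrt (hpos y).inv)
      (fun v => measurable_toEuclideanCLM_apply hR measurable_const) hw (fun y => ?_)
      fun y u hu => ?_
    · exact (Set.ext_iff.1 (ellipsoid_eq (hpos y)) _).1 (proj_ellipsoid_spec (hpos y) (w y)).1
    · rw [toEuclideanCLM_sqrt_inv_apply (hpos y)]
      refine (proj_ellipsoid_spec (hpos y) (w y)).2 _ ?_
      rw [ellipsoid_eq (hpos y), Set.mem_preimage, toEuclideanCLM_sqrt_apply (hpos y)]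
      exact hu
  have := measurable_toEuclideanCLM_apply hR hm
  simpa only [toEuclideanCLM_sqrt_inv_apply (hpos _)] using this

end Argmin

/-! ### Measurability of the iterates -/

theorem measurable_finInit {d k : ℕ} :
    Measurable fun h : Fin (k + 1) → Vec d => (Fin.init h : Fin k → Vec d) :=
  measurable_pi_lambda _ fun i => measurable_pi_apply i.castSucc

theorem measurable_pasanIter {d : ℕ} {X : Set (Vec d)} (hX : Convex ℝ X) (hXc : IsClosed X)
    {x₀ : Vec d} (hx₀ : x₀ ∈ X) (α : ℝ) : ∀ k, Measurable (pasanIter X x₀ α k)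
  | 0 => measurable_const
  | k + 1 => by
    have ih := (measurable_pasanIter hX hXc hx₀ α k).comp measurable_finInit
    refine measurable_proj hXc hX ⟨x₀, hx₀⟩ (ih.sub ?_)
    fun_prop

theorem posDef_adagradMatrix_iff {d m : ℕ} {α : ℝ} (hα : 0 < α) (h : Fin m → Vec d) :
    (adagradMatrix α h).PosDef ↔ ∀ j, 0 < ∑ i, h i j ^ 2 := by
  rw [adagradMatrix, ← Matrix.diagonal_smul, Matrix.posDef_diagonal_iff]
  refine forall_congr' fun j => ?_
  rw [Pi.smul_apply, smul_eq_mul, mul_pos_iff_of_pos_left (by positivity), Real.sqrt_pos]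

theorem measurable_paganIter {d : ℕ} {X : Set (Vec d)} (hX : Convex ℝ X) (hXc : IsClosed X)
    {x₀ : Vec d} (hx₀ : x₀ ∈ X) {α : ℝ} (hα : 0 < α) : ∀ k, Measurable (paganIter X x₀ α k)
  | 0 => measurable_const
  | k + 1 => by
    classical
    have ih : Measurable fun h : Fin (k + 1) → Vec d => paganIter X x₀ α k (Fin.init h) :=
      (measurable_paganIter hX hXc hx₀ hα k).comp measurable_finInit
    have hset : MeasurableSet {h : Fin (k + 1) → Vec d | (adagradMatrix α h).PosDef} := by
      simp only [posDef_adagradMatrix_iff hα, Set.ofPred_forall]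
      exact MeasurableSet.iInter fun j => measurableSet_lt measurable_const (by fun_prop)
    -- The singular case is replaced by the identity so that the preconditioner is positive definite
    -- for every history; the values there are discarded at the end.
    set H : (Fin (k + 1) → Vec d) → Matrix (Fin d) (Fin d) ℝ := fun h =>
      if (adagradMatrix α h).PosDef then adagradMatrix α h else 1 with hH
    have hpos : ∀ h, (H h).PosDef := by
      intro h
      simp only [hH]
      split_ifs with hp
      exacts [hp, Matrix.PosDef.one]
    have hada : ∀ p q, Measurable fun h : Fin (k + 1) → Vec d => adagradMatrix α h p q := by
      intro p q
      simp only [adagradMatrix, Matrix.smul_apply, Matrix.diagonal_apply]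
      split_ifs
      · fun_prop
      · exact measurable_const
    have hm : ∀ p q, Measurable fun h => H h p q := by
      intro p q
      have : (fun h => H h p q) = fun h => if (adagradMatrix α h).PosDef
          then adagradMatrix α h p q else (1 : Matrix (Fin d) (Fin d) ℝ) p q := by
        ext h
        simp only [hH]
        split_ifs <;> rfl
      rw [this]
      exact Measurable.ite hset (hada p q) measurable_const
    have hproj : Measurable fun h => projWrt (H h) X (paganIter X x₀ α k (Fin.init h) -
        Matrix.toEuclideanCLM (𝕜 := ℝ) (H h)⁻¹ (h (Fin.last k))) :=
      measurable_projWrt hXc hX ⟨x₀, hx₀⟩ hm hpos (ih.sub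
        (measurable_toEuclideanCLM_apply (measurable_matrix_inv hm) (measurable_pi_apply _)))
    have : paganIter X x₀ α (k + 1) = fun h => if (adagradMatrix α h).PosDef then
        projWrt (H h) X (paganIter X x₀ α k (Fin.init h) -
          Matrix.toEuclideanCLM (𝕜 := ℝ) (H h)⁻¹ (h (Fin.last k)))
        else paganIter X x₀ α k (Fin.init h) := by
      ext1 h
      by_cases hp : (adagradMatrix α h).PosDef
      · simp only [paganIter, hH, if_pos hp]
      · simp only [paganIter, if_neg hp]
    rw [this]
    exact Measurable.ite hset hproj ih

/-! ### The private gradients -/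

section History

variable {n b d : ℕ} {Z : Type*} {ε δ : ℝ}

theorem privateGradient_eq (g : Fin b → Vec d → Z → Vec d) (S : Fin n → Z) (x : Vec d)
    (A : Matrix (Fin d) (Fin d) ℝ) :
    privateGradient ε δ g S x A = noisyMean (Matrix.toEuclideanCLM (𝕜 := ℝ) (CFC.sqrt A⁻¹))
      (√(Real.log (1 / δ)) / ε) fun i a => proj (ellipsoid A) (g i x (S a)) := by
  ext1 ω
  rw [privateGradient, noisyMean, div_div, mul_comm ε]
  rfl

theorem measurable_privateGradient {Y : Type*} [MeasurableSpace Y] {g : Fin b → Vec d → Z → Vec d}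
    (hg : ∀ i z, Measurable fun x => g i x z) (S : Fin n → Z) {x : Y → Vec d} (hx : Measurable x)
    {A : Y → Matrix (Fin d) (Fin d) ℝ} (hA : ∀ p q, Measurable fun y => A y p q)
    (hpos : ∀ y, (A y).PosDef) :
    Measurable (Function.uncurry fun y => privateGradient ε δ g S (x y) (A y)) := by
  have hR := measurable_matrix_sqrt (measurable_matrix_inv hA) fun y => (hpos y).inv.posSemidef
  have hsum : Measurable fun ω : Y × Draw n b d =>
      ∑ i, proj (ellipsoid (A ω.1)) (g i (x ω.1) (S (ω.2.1 i))) := by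
    have h1 : Measurable fun q : Y × (Fin b → Fin n) =>
        ∑ i, proj (ellipsoid (A q.1)) (g i (x q.1) (S (q.2 i))) :=
      measurable_from_prod_countable_left fun idx => by
        dsimp only
        exact Finset.measurable_sum _ fun i _ => measurable_proj_ellipsoid hA hpos
          (w := fun y => g i (x y) (S (idx i))) ((hg i _).comp hx)
    have h2 : Measurable fun ω : Y × Draw n b d => ((ω.1, ω.2.1) : Y × (Fin b → Fin n)) :=
      measurable_fst.prodMk (measurable_fst.comp measurable_snd)
    simpa only [Function.comp_def] using h1.comp h2
  have hnoise : Measurable fun ω : Y × Draw n b d => colour (A ω.1)⁻¹ ω.2.2 :=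
    measurable_toEuclideanCLM_apply (M := fun ω : Y × Draw n b d => CFC.sqrt (A ω.1)⁻¹)
      (fun p q => (hR p q).comp measurable_fst) (measurable_snd.comp measurable_snd)
  unfold Function.uncurry privateGradient
  exact (hsum.const_smul (1 / (b : ℝ))).add
    (hnoise.const_smul (√(Real.log (1 / δ)) / ((b : ℝ) * ε)))

theorem measurePreserving_init_last [NeZero n] (k : ℕ) :
    MeasurePreserving (fun ω : Fin (k + 1) → Draw n b d => (Fin.init ω, ω (Fin.last k)))
      (runLaw n b d (k + 1)) ((runLaw n b d k).prod (drawLaw n b d)) := by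
  have h := measurePreserving_piFinSuccAbove (fun _ : Fin (k + 1) => drawLaw n b d) (Fin.last k)
  have h2 := (Measure.measurePreserving_swap (μ := drawLaw n b d)
    (ν := Measure.pi fun _ : Fin k => drawLaw n b d)).comp h
  have he : (fun ω : Fin (k + 1) → Draw n b d => (Fin.init ω, ω (Fin.last k))) =
      Prod.swap ∘ MeasurableEquiv.piFinSuccAbove (fun _ : Fin (k + 1) => Draw n b d)
        (Fin.last k) := by
    ext1 ω
    simp [MeasurableEquiv.piFinSuccAbove, Fin.insertNthEquiv, Fin.init_def]
  rw [he]
  exact h2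

theorem measurable_finSnoc {k : ℕ} :
    Measurable fun q : (Fin k → Vec d) × Vec d => (Fin.snoc q.1 q.2 : Fin (k + 1) → Vec d) := by
  refine measurable_pi_lambda _ fun i => ?_
  refine Fin.lastCases ?_ (fun i => ?_) i
  · simpa using measurable_snd
  · simpa [Function.comp_def] using (measurable_pi_apply i).comp
      (measurable_fst : Measurable fun q : (Fin k → Vec d) × Vec d => q.1)

variable {g : ℕ → Fin b → Vec d → Z → Vec d}
  {A : (k : ℕ) → (Fin k → Vec d) → Matrix (Fin d) (Fin d) ℝ}
  {iter : (k : ℕ) → (Fin k → Vec d) → Vec d}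

theorem measurable_history (hg : ∀ k i z, Measurable fun x => g k i x z)
    (hA : ∀ k p q, Measurable fun h => A k h p q) (hpos : ∀ k h, (A k h).PosDef)
    (hiter : ∀ k, Measurable (iter k)) (S : Fin n → Z) :
    ∀ k, Measurable (history (n := n) ε δ g A iter S k)
  | 0 => measurable_const
  | k + 1 => by
    have hinit : Measurable fun ω : Fin (k + 1) → Draw n b d =>
        history ε δ g A iter S k (Fin.init ω) :=
      (measurable_history hg hA hpos hiter S k).comp
        (measurable_pi_lambda _ fun i => measurable_pi_apply i.castSucc)
    exact measurable_finSnoc.comp (hinit.prodMk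
      ((measurable_privateGradient (hg k) S (hiter k) (hA k) (hpos k)).comp
        (hinit.prodMk (measurable_pi_apply (Fin.last k)))))

theorem IsHoelderClose.comp_measurePreserving {lam τ G : ℝ} {Ω Ω' W : Type*} [MeasurableSpace Ω]
    [MeasurableSpace Ω'] [MeasurableSpace W] {P : Measure Ω} {P' : Measure Ω'} {f f' : Ω → W}
    (h : IsHoelderClose lam τ G P f f') (hf : Measurable f) (hf' : Measurable f') {e : Ω' → Ω}
    (he : MeasurePreserving e P' P) :
    IsHoelderClose lam τ G P' (fun ω => f (e ω)) (fun ω => f' (e ω)) := by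
  intro φ hφ hφ1
  have h1 := h φ hφ hφ1
  rw [← he.lintegral_comp (f := fun ω => φ (f ω)) (hφ.comp hf),
    ← he.lintegral_comp (f := fun ω => φ (f' ω) ^ ((1 + lam) / lam))
      ((hφ.comp hf').pow_const _)] at h1
  exact h1

/-- Divergences add along the history. An earlier truncation error is multiplied by `exp (G / (1 +
lam))` at each later step, which the factor `exp (k (G / (1 + lam)))` covers. -/
theorem isHoelderClose_history (hn : 2 ≤ n) (hb : 1 ≤ b) {s lam τ G : ℝ}
    (hsε : s = √(Real.log (1 / δ)) / ε) (hs : 1 ≤ s)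
    (hlam : 1 ≤ lam) (hσ1 : Real.log (√(2 * b / n)) ≤ -33)
    (hlamσ : 32 * (lam * (2 / s) ^ 2 * √(2 * b / n)) ≤ 1)
    (hτ : τ = √(2 * b / n) ^ 4 * Real.exp (-s ^ 2))
    (hG : G = lam * τ + renyiConst * (lam * √(2 * b / n) ^ 2 * (2 / s)) ^ 2)
    (hg : ∀ k i z, Measurable fun x => g k i x z)
    (hA : ∀ k p q, Measurable fun h => A k h p q) (hpos : ∀ k h, (A k h).PosDef)
    (hiter : ∀ k, Measurable (iter k)) {S S' : Fin n → Z} (hSS : Neighboring S S') (k : ℕ) :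
    IsHoelderClose lam (k * τ * Real.exp (k * (G / (1 + lam)))) (k * G) (runLaw n b d k)
      (history ε δ g A iter S k) (history ε δ g A iter S' k) := by
  have : NeZero n := ⟨by omega⟩
  obtain ⟨j, hj⟩ := hSS
  have hτ0 : 0 ≤ τ := by rw [hτ]; positivity
  have hG0 : 0 ≤ G := by
    have := renyiConst_pos
    rw [hG]; positivity
  have hlam0 : 0 < lam := by linarith
  have hrun : ∀ k, IsProbabilityMeasure (runLaw n b d k) := fun k => by
    unfold runLaw; infer_instance
  have hstep : ∀ k h, IsHoelderClose lam τ G (drawLaw n b d)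
      (privateGradient ε δ (g k) S (iter k h) (A k h))
      (privateGradient ε δ (g k) S' (iter k h) (A k h)) := by
    intro k h
    rw [privateGradient_eq, privateGradient_eq, ← hsε, hG, hτ]
    have hball : ∀ v, ‖Matrix.toEuclideanCLM (𝕜 := ℝ) (CFC.sqrt (A k h))
        (proj (ellipsoid (A k h)) v)‖ ≤ 1 := fun v => by
      rw [← mahalanobis_eq_norm (hpos k h).posSemidef]
      exact (proj_ellipsoid_spec (hpos k h) v).1
    exact isHoelderClose_noisyMean hn hb hs hlam hσ1 hlamσ
      (toEuclideanCLM_sqrt_inv_apply (hpos k h)) (fun i a => hball _) (fun i a => hball _) (j := j)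
      fun i a ha => by rw [hj a ha]
  induction k with
  | zero => exact IsHoelderClose.const hlam0 (by simp) _ _
  | succ k ih =>
    have hm := fun S : Fin n → Z =>
      measurable_history (ε := ε) (δ := δ) hg hA hpos hiter S k
    have hp := fun S : Fin n → Z => measurable_privateGradient (ε := ε) (δ := δ)
      (hg k) S (hiter k) (hA k) (hpos k)
    have h1 := ((ih.prod hlam0 (hm S) (hm S') (hp S) (hp S') (hstep k) (by positivity) hτ0).comp
      measurable_finSnoc)
    have hm2 : ∀ S : Fin n → Z, Measurable fun ω : (Fin k → Draw n b d) × Draw n b d =>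
        (Fin.snoc (history ε δ g A iter S k ω.1) (privateGradient ε δ (g k) S
          (iter k (history ε δ g A iter S k ω.1)) (A k (history ε δ g A iter S k ω.1)) ω.2) :
          Fin (k + 1) → Vec d) := fun S =>
      measurable_finSnoc.comp (((hm S).comp measurable_fst).prodMk ((hp S).comp
        (((hm S).comp measurable_fst).prodMk measurable_snd)))
    have h2 := h1.comp_measurePreserving (hm2 S) (hm2 S') (measurePreserving_init_last k)
    refine h2.mono hlam0 ?_ ?_
    · have hE : 0 ≤ G / (1 + lam) := by positivity
      have h3 : Real.exp (((k + 1 : ℕ) : ℝ) * (G / (1 + lam))) =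
          Real.exp (G / (1 + lam)) * Real.exp (k * (G / (1 + lam))) := by
        rw [← Real.exp_add]
        congr 1
        push_cast
        ring
      have h4 : 1 ≤ Real.exp (((k + 1 : ℕ) : ℝ) * (G / (1 + lam))) :=
        Real.one_le_exp (by positivity)
      calc τ + Real.exp (G / (1 + lam)) * (k * τ * Real.exp (k * (G / (1 + lam))))
          = τ * 1 + k * τ * Real.exp (((k + 1 : ℕ) : ℝ) * (G / (1 + lam))) := by rw [h3]; ring
        _ ≤ τ * Real.exp (((k + 1 : ℕ) : ℝ) * (G / (1 + lam))) +
            k * τ * Real.exp (((k + 1 : ℕ) : ℝ) * (G / (1 + lam))) := by gcongr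
        _ = _ := by push_cast; ring
    · push_cast
      linarith

theorem measurable_averageIterate (hiter : ∀ k, Measurable (iter k)) (T : ℕ) :
    Measurable (averageIterate iter T) := by
  unfold averageIterate
  have hsum : Measurable fun h : Fin T → Vec d =>
      ∑ k : Fin T, iter (k + 1) fun i => h (Fin.castLE k.isLt i) :=
    Finset.measurable_sum _ fun k _ => (hiter _).comp
      (measurable_pi_lambda _ fun i => measurable_pi_apply _)
  exact hsum.const_smul (1 / (T : ℝ))

end History

/-! ### Choice of the parameters -/

/-- The absolute constant in the bound on the number of iterations. -/
def iterationConst : ℝ := Real.exp (-132) / (256000 * renyiConst)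

theorem iterationConst_pos : 0 < iterationConst := by
  have := renyiConst_pos
  unfold iterationConst
  positivity

theorem one_le_renyiConst : 1 ≤ renyiConst := by
  unfold renyiConst
  linarith [Real.exp_pos 145]

theorem iterationConst_le : iterationConst ≤ Real.exp (-132) / 4 := by
  have := one_le_renyiConst
  unfold iterationConst
  gcongr
  linarith

theorem iterationConst_le' : iterationConst ≤ 1 / 256000 := by
  have h1 := one_le_renyiConst
  have h2 : Real.exp (-132) ≤ 1 := Real.exp_le_one_iff.2 (by norm_num)
  unfold iterationConst
  rw [div_le_div_iff₀ (by linarith) (by norm_num)]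
  nlinarith

theorem iterationConst_mul_renyiConst_le : iterationConst * renyiConst ≤ 1 / 256000 := by
  have h1 := renyiConst_pos
  have h2 : Real.exp (-132) ≤ 1 := Real.exp_le_one_iff.2 (by norm_num)
  have h3 : iterationConst * renyiConst = Real.exp (-132) / 256000 := by
    unfold iterationConst
    field_simp
  rw [h3]
  gcongr

section Parameters

variable {n b T : ℕ}

theorem mul_sq_ratio_le (hn : 1 ≤ n) (hb : 1 ≤ b)
    (hT : (T : ℝ) ≤ iterationConst * (n : ℝ) ^ 2 / (b : ℝ) ^ 2) :
    T * ((b : ℝ) / n) ^ 2 ≤ iterationConst := by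
  have hn' : (0 : ℝ) < n := by exact_mod_cast hn
  have hb' : (0 : ℝ) < b := by exact_mod_cast hb
  calc T * ((b : ℝ) / n) ^ 2
      ≤ iterationConst * (n : ℝ) ^ 2 / (b : ℝ) ^ 2 * ((b : ℝ) / n) ^ 2 := by gcongr
    _ = iterationConst := by field_simp

/-- A single iteration already forces `(b/n)²` below the iteration constant; the factor `exp (-132)`
in that constant is there to make `log σ ≤ -33` for `σ² = 2b/n`. -/
theorem two_mul_ratio_le (hn : 1 ≤ n) (hb : 1 ≤ b) (hT1 : 1 ≤ T)
    (hT : (T : ℝ) ≤ iterationConst * (n : ℝ) ^ 2 / (b : ℝ) ^ 2) :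
    2 * (b : ℝ) / n ≤ Real.exp (-66) := by
  have h1 := mul_sq_ratio_le hn hb hT
  have hT1' : (1 : ℝ) ≤ T := by exact_mod_cast hT1
  have h2 : (2 * (b : ℝ) / n) ^ 2 ≤ Real.exp (-66) ^ 2 := by
    have h3 : Real.exp (-66) ^ 2 = Real.exp (-132) := by
      rw [← Real.exp_nat_mul]; norm_num
    have h4 : (2 * (b : ℝ) / n) ^ 2 = 4 * ((b : ℝ) / n) ^ 2 := by ring
    rw [h3, h4]
    nlinarith [iterationConst_le, sq_nonneg ((b : ℝ) / n)]
  exact le_of_sq_le_sq h2 (Real.exp_pos _).le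

theorem log_sqrt_ratio_le (hn : 1 ≤ n) (hb : 1 ≤ b) (hT1 : 1 ≤ T)
    (hT : (T : ℝ) ≤ iterationConst * (n : ℝ) ^ 2 / (b : ℝ) ^ 2) :
    Real.log (√(2 * b / n)) ≤ -33 := by
  have hn' : (0 : ℝ) < n := by exact_mod_cast hn
  have hb' : (0 : ℝ) < b := by exact_mod_cast hb
  have h1 := Real.log_le_log (by positivity) (two_mul_ratio_le hn hb hT1 hT)
  rw [Real.log_exp] at h1
  rw [Real.log_sqrt (by positivity)]
  linarith

theorem two_le_of_iterations (hn : 1 ≤ n) (hb : 1 ≤ b) (hT1 : 1 ≤ T)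
    (hT : (T : ℝ) ≤ iterationConst * (n : ℝ) ^ 2 / (b : ℝ) ^ 2) : 2 ≤ n := by
  have hn' : (0 : ℝ) < n := by exact_mod_cast hn
  have hb' : (1 : ℝ) ≤ b := by exact_mod_cast hb
  have h1 : 2 * (b : ℝ) / n ≤ 1 :=
    (two_mul_ratio_le hn hb hT1 hT).trans (Real.exp_le_one_iff.2 (by norm_num))
  rw [div_le_one hn'] at h1
  exact_mod_cast (by linarith : (2 : ℝ) ≤ n)

/-- With the chosen parameters the divergence accumulated over all iterations is at most half
of the privacy budget. -/
theorem mul_divergence_le (hn : 1 ≤ n) (hb : 1 ≤ b)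
    (hT : (T : ℝ) ≤ iterationConst * (n : ℝ) ^ 2 / (b : ℝ) ^ 2) {s ε lam τ G : ℝ} (hs : 1 ≤ s)
    (hε : 0 < ε) (hsε : 1 / 10 ≤ s * ε) (hlam : lam = 1000 * s ^ 2 * ε)
    (hτ : τ = √(2 * b / n) ^ 4 * Real.exp (-s ^ 2))
    (hG : G = lam * τ + renyiConst * (lam * √(2 * b / n) ^ 2 * (2 / s)) ^ 2) :
    T * τ ≤ 4 * iterationConst * Real.exp (-s ^ 2) ∧ T * G ≤ 1 / 2 * (lam * ε) := by
  have hn' : (0 : ℝ) < n := by exact_mod_cast hn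
  have hb' : (0 : ℝ) < b := by exact_mod_cast hb
  have hs0 : 0 < s := by linarith
  have hlam0 : 0 < lam := by rw [hlam]; positivity
  have hq := mul_sq_ratio_le hn hb hT
  have hsq : √(2 * b / n : ℝ) ^ 2 = 2 * (b / n) := by
    rw [Real.sq_sqrt (by positivity)]; ring
  have h4 : √(2 * b / n : ℝ) ^ 4 = 4 * (b / n : ℝ) ^ 2 := by
    rw [show (4 : ℕ) = 2 * 2 by norm_num, pow_mul, hsq]; ring
  have hTτ : T * τ ≤ 4 * iterationConst * Real.exp (-s ^ 2) := by
    calc T * τ = 4 * (T * ((b : ℝ) / n) ^ 2) * Real.exp (-s ^ 2) := by rw [hτ, h4]; ring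
      _ ≤ _ := by gcongr
  refine ⟨hTτ, ?_⟩
  -- The truncation error enters the divergence multiplied by `lam`, so it has to be compared with
  -- `ε`: `exp (-s²) ≤ 1/s ≤ 10 ε`.
  have hexp : Real.exp (-s ^ 2) ≤ 10 * ε := by
    have h1 : s ≤ Real.exp (s ^ 2) := by nlinarith [Real.add_one_le_exp (s ^ 2)]
    rw [Real.exp_neg]
    calc (Real.exp (s ^ 2))⁻¹ ≤ s⁻¹ := inv_anti₀ hs0 h1
      _ ≤ 10 * ε := by
        rw [inv_le_iff_one_le_mul₀ hs0]
        linarith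
  have h1 : T * τ ≤ ε / 4 := by
    have := iterationConst_le'
    have hc := iterationConst_pos
    calc _ ≤ 4 * iterationConst * (10 * ε) := hTτ.trans (by gcongr)
      _ ≤ ε / 4 := by nlinarith
  have h2 : renyiConst * (T * (lam * √(2 * b / n : ℝ) ^ 2 * (2 / s)) ^ 2) ≤ lam * (ε / 4) := by
    have hr := renyiConst_pos
    have hcr := iterationConst_mul_renyiConst_le
    calc _ = (T * ((b : ℝ) / n) ^ 2) * renyiConst * (16 * lam ^ 2 / s ^ 2) := by
          rw [hsq]; field_simp; ring
      _ ≤ iterationConst * renyiConst * (16 * lam ^ 2 / s ^ 2) := by gcongr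
      _ ≤ 1 / 256000 * (16 * lam ^ 2 / s ^ 2) := by gcongr
      _ ≤ lam * (ε / 4) := by
          -- One factor `lam` is replaced by `1000 s² ε`; dividing by 256000 then leaves `lam ε /
          -- 16`.
          have h3 : 16 * lam ^ 2 / s ^ 2 = 16000 * lam * ε := by
            rw [sq lam]
            nth_rw 2 [hlam]
            field_simp
            norm_num
          rw [h3]
          nlinarith [mul_pos hlam0 hε]
  calc T * G = lam * (T * τ) + renyiConst * (T * (lam * √(2 * b / n : ℝ) ^ 2 * (2 / s)) ^ 2) := by
        rw [hG]; ring
    _ ≤ lam * (ε / 4) + lam * (ε / 4) := by gcongr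
    _ = _ := by ring

end Parameters

section Privacy

variable {n b d T : ℕ} {Z : Type*} {g : ℕ → Fin b → Vec d → Z → Vec d}
  {A : (k : ℕ) → (Fin k → Vec d) → Matrix (Fin d) (Fin d) ℝ}
  {iter : (k : ℕ) → (Fin k → Vec d) → Vec d}

/-- The noise is calibrated to `ε₀`, while `ε` is the level that is certified. They are kept apart
so that for `δ` near 1 the same noise can be analysed at a larger level. -/
theorem measure_averageIterate_le {ε₀ δ ε s : ℝ} (hn : 1 ≤ n) (hb : 1 ≤ b) (hT1 : 1 ≤ T)
    (hT : (T : ℝ) ≤ iterationConst * (n : ℝ) ^ 2 / (b : ℝ) ^ 2)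
    (hsε₀ : s = √(Real.log (1 / δ)) / ε₀) (hs : 1 ≤ s) (hε : 0 < ε) (hε1 : ε ≤ 1 / 10)
    (hsε : 1 / 10 ≤ s * ε)
    (hg : ∀ k i z, Measurable fun x => g k i x z)
    (hA : ∀ k p q, Measurable fun h => A k h p q) (hpos : ∀ k h, (A k h).PosDef)
    (hiter : ∀ k, Measurable (iter k)) {S S' : Fin n → Z} (hSS : Neighboring S S')
    {O : Set (Vec d)} (hO : MeasurableSet O) :
    runLaw n b d T {ω | averageIterate iter T (history ε₀ δ g A iter S T ω) ∈ O} ≤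
      ENNReal.ofReal (Real.exp ε) *
        runLaw n b d T {ω | averageIterate iter T (history ε₀ δ g A iter S' T ω) ∈ O} +
      ENNReal.ofReal (8 * iterationConst * Real.exp (-s ^ 2) +
        Real.exp (-(500 * (s * ε) ^ 2))) := by
  have hn2 := two_le_of_iterations hn hb hT1 hT
  have hlog := log_sqrt_ratio_le hn hb hT1 hT
  have hn' : (0 : ℝ) < n := by exact_mod_cast hn
  have hb' : (0 : ℝ) < b := by exact_mod_cast hb
  have hs0 : 0 < s := by linarith
  -- The accumulated divergence grows like `lam²/s²` and must stay below half of `lam ε`, so `lam`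
  -- is of order `s² ε`; the other half of `lam ε` gives the failure probability `exp (-500 (s
  -- ε)²)`.
  set lam := 1000 * s ^ 2 * ε with hlam
  have hlam1 : 1 ≤ lam := by nlinarith
  have hlam0 : 0 < lam := by linarith
  set τ := √(2 * b / n : ℝ) ^ 4 * Real.exp (-s ^ 2) with hτ
  set G := lam * τ + renyiConst * (lam * √(2 * b / n : ℝ) ^ 2 * (2 / s)) ^ 2 with hG
  have hσ : √(2 * b / n : ℝ) ≤ 1 / 128000 * (1 / 10) := by
    rw [← Real.exp_log (Real.sqrt_pos.2 (by positivity : (0 : ℝ) < 2 * b / n))]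
    calc _ ≤ Real.exp (-33) := Real.exp_le_exp.2 hlog
      _ = (Real.exp 1 ^ 33)⁻¹ := by rw [← Real.exp_nat_mul, ← Real.exp_neg]; norm_num
      _ ≤ (2 ^ 33)⁻¹ := by
        gcongr
        linarith [Real.exp_one_gt_d9]
      _ ≤ _ := by norm_num
  have hlamσ : 32 * (lam * (2 / s) ^ 2 * √(2 * b / n : ℝ)) ≤ 1 := by
    have h1 : lam * (2 / s) ^ 2 = 4000 * ε := by rw [hlam]; field_simp; norm_num
    rw [h1]
    have h0 : 0 ≤ √(2 * b / n : ℝ) := Real.sqrt_nonneg _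
    nlinarith
  obtain ⟨hTτ, hTG⟩ := mul_divergence_le hn hb hT hs hε hsε hlam hτ hG
  have hτ0 : 0 ≤ τ := by positivity
  have hclose := (isHoelderClose_history hn2 hb hsε₀ hs hlam1 hlog hlamσ hτ hG hg hA hpos hiter
    hSS T).comp (measurable_averageIterate hiter T)
  have hm := fun S : Fin n → Z => (measurable_averageIterate hiter T).comp
    (measurable_history (ε := ε₀) (δ := δ) hg hA hpos hiter S T)
  refine (hclose.measure_le hlam0 (hm S) (hm S') ε hO).trans (add_le_add le_rfl ?_)
  rw [← ENNReal.ofReal_add (by positivity) (by positivity)]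
  refine ENNReal.ofReal_le_ofReal (add_le_add ?_ (Real.exp_le_exp.2 ?_))
  · have h1 : T * (G / (1 + lam)) ≤ 1 / 2 := by
      rw [mul_div_assoc', div_le_iff₀ (by linarith)]
      nlinarith
    have h2 : Real.exp (T * (G / (1 + lam))) ≤ 2 := by
      calc _ ≤ Real.exp (1 / 2) := Real.exp_le_exp.2 h1
        _ ≤ 2 := by
          have h4 : Real.exp (1 / 2) ^ 2 = Real.exp 1 := by rw [← Real.exp_nat_mul]; norm_num
          have := Real.exp_one_lt_d9
          nlinarith [Real.exp_pos (1 / 2)]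
    calc T * τ * Real.exp (T * (G / (1 + lam)))
        ≤ 4 * iterationConst * Real.exp (-s ^ 2) * 2 := by
          have := iterationConst_pos
          gcongr
      _ = _ := by ring
  · have : lam * ε = 1000 * (s * ε) ^ 2 := by rw [hlam]; ring
    linarith

/-- Any method whose iterates are measurable functions of the private gradients is
differentially private. -/
theorem isDP_averageIterate {ε δ : ℝ} (hn : 1 ≤ n) (hb : 1 ≤ b)
    (hT : (T : ℝ) ≤ iterationConst * (n : ℝ) ^ 2 / (b : ℝ) ^ 2)
    (hε : 0 < ε) (hε1 : ε ≤ 1 / 10) (hδ : 0 < δ) (hεδ : ε ^ 2 ≤ Real.log (1 / δ))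
    (hg : ∀ k i z, Measurable fun x => g k i x z)
    (hA : ∀ k p q, Measurable fun h => A k h p q) (hpos : ∀ k h, (A k h).PosDef)
    (hiter : ∀ k, Measurable (iter k)) :
    IsDP (runLaw n b d T)
      (fun (S : Fin n → Z) ω => averageIterate iter T (history ε δ g A iter S T ω)) ε δ := by
  intro S S' hSS O hO
  have hexpε : 1 ≤ ENNReal.ofReal (Real.exp ε) := by
    rw [ENNReal.one_le_ofReal]; exact Real.one_le_exp hε.le
  rcases Nat.eq_zero_or_pos T with rfl | hT1
  -- With no iterations the output is the same constant for both datasets.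
  · exact (le_mul_of_one_le_left' hexpε).trans le_self_add
  set m := Real.log (1 / δ) with hm
  have hδm : δ = Real.exp (-m) := by
    rw [hm, one_div, Real.log_inv, neg_neg, Real.exp_log hδ]
  set s := √m / ε with hsdef
  have hm0 : 0 < m := lt_of_lt_of_le (by positivity) hεδ
  have hs : 1 ≤ s := by
    rw [hsdef, le_div_iff₀ hε, one_mul]
    exact Real.le_sqrt_of_sq_le hεδ
  have hsε : s * ε = √m := by rw [hsdef]; field_simp
  have hs2 : s ^ 2 * ε ^ 2 = m := by rw [← mul_pow, hsε, Real.sq_sqrt hm0.le]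
  have hc := iterationConst_le'
  have hc0 := iterationConst_pos
  rcases le_total 1 m with hm1 | hm1
  · refine (measure_averageIterate_le hn hb hT1 hT hsdef hs hε hε1 ?_ hg hA hpos hiter hSS
      hO).trans (add_le_add le_rfl (ENNReal.ofReal_le_ofReal ?_))
    · rw [hsε]
      exact le_trans (by norm_num) (Real.one_le_sqrt.2 hm1)
    · rw [hsε, Real.sq_sqrt hm0.le, hδm]
      have h1 : m ≤ s ^ 2 := by
        rw [← hs2]
        exact mul_le_of_le_one_right (sq_nonneg s) (pow_le_one₀ hε.le (by linarith))
      have h2 : Real.exp (-s ^ 2) ≤ Real.exp (-m) := Real.exp_le_exp.2 (by linarith)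
      have h3 : Real.exp (-(500 * m)) ≤ Real.exp (-1) * Real.exp (-m) := by
        rw [← Real.exp_add]
        exact Real.exp_le_exp.2 (by linarith)
      have h4 : Real.exp (-1) ≤ 1 / 2 := by
        rw [Real.exp_neg, one_div]
        exact inv_anti₀ (by norm_num) (by linarith [Real.exp_one_gt_d9])
      have h5 := Real.exp_pos (-m)
      have h6 : 8 * iterationConst * Real.exp (-s ^ 2) ≤ 1 / 2 * Real.exp (-m) := by
        gcongr
        linarith
      nlinarith
  -- Here `log (1/δ) ≤ 1`, and `s ε` may be too small for the level `ε`. At the level `1/10` the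
  -- condition reduces to `s ≥ 1`. The price `e^{1/10} - 1 ≤ 1/8`, the tail `exp (-5) ≤ 1/6` and the
  -- truncation error together stay below `1/3 ≤ δ`.
  · have h := measure_averageIterate_le hn hb hT1 hT hsdef hs (by norm_num : (0 : ℝ) < 1 / 10)
      le_rfl (by linarith) hg hA hpos hiter hSS hO
    refine h.trans ?_
    set Q := runLaw n b d T {ω | averageIterate iter T (history ε δ g A iter S' T ω) ∈ O}
    have : NeZero n := ⟨by omega⟩
    have hprob : IsProbabilityMeasure (runLaw n b d T) := by unfold runLaw; infer_instance
    have hQ1 : Q ≤ 1 := prob_le_one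
    have he : Real.exp (1 / 10) ≤ 1 + 1 / 8 := by
      have := Real.exp_bound_div_one_sub_of_interval (x := 1 / 10) (by norm_num) (by norm_num)
      exact this.trans (by norm_num)
    have hb1 : ENNReal.ofReal (Real.exp (1 / 10)) * Q ≤
        ENNReal.ofReal (Real.exp ε) * Q + ENNReal.ofReal (1 / 8) := by
      calc _ ≤ ENNReal.ofReal (1 + 1 / 8) * Q := by gcongr
        _ = 1 * Q + ENNReal.ofReal (1 / 8) * Q := by
          rw [ENNReal.ofReal_add zero_le_one (by norm_num), ENNReal.ofReal_one, add_mul]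
        _ ≤ _ := by
          gcongr
          exact mul_le_of_le_one_right' hQ1
    refine (add_le_add hb1 le_rfl).trans ?_
    rw [add_assoc, ← ENNReal.ofReal_add (by norm_num) (by positivity)]
    refine add_le_add le_rfl (ENNReal.ofReal_le_ofReal ?_)
    have h1 : Real.exp (-s ^ 2) ≤ 1 := Real.exp_le_one_iff.2 (by nlinarith)
    have h2 : Real.exp (-(500 * (s * (1 / 10)) ^ 2)) ≤ 1 / 6 := by
      calc _ ≤ Real.exp (-5) := Real.exp_le_exp.2 (by nlinarith)
        _ ≤ 1 / 6 := by
          rw [Real.exp_neg, one_div]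
          exact inv_anti₀ (by norm_num) (by linarith [Real.add_one_le_exp (5 : ℝ)])
    have h3 : 1 / 3 ≤ δ := by
      rw [hδm]
      calc (1 / 3 : ℝ) ≤ Real.exp (-1) := by
            rw [Real.exp_neg, one_div]
            exact inv_anti₀ (Real.exp_pos 1) (by linarith [Real.exp_one_lt_d9])
        _ ≤ _ := Real.exp_le_exp.2 (by linarith)
    nlinarith

end Privacy

end

end PrivateAdaptive

theorem mainTheorem7 :
    ∃ εbar : ℝ, 0 < εbar ∧ ∃ c : ℝ, 0 < c ∧
      ∀ (n b d T : ℕ), 1 ≤ n → 1 ≤ b → (T : ℝ) ≤ c * (n : ℝ) ^ 2 / (b : ℝ) ^ 2 →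
      ∀ (ε δ : ℝ), 0 < ε → ε ≤ εbar → 0 < δ → ε ^ 2 ≤ Real.log (1 / δ) →
      ∀ (Z : Type*) (X : Set (PrivateAdaptive.Vec d)), Convex ℝ X → IsClosed X →
      ∀ F : PrivateAdaptive.Vec d → Z → ℝ, (∀ z, ConvexOn ℝ X fun x => F x z) →
      ∀ g : ℕ → Fin b → PrivateAdaptive.Vec d → Z → PrivateAdaptive.Vec d,
        (∀ k i z, Measurable fun x => g k i x z) →
        (∀ k i z, ∀ x ∈ X,
          g k i x z ∈ PrivateAdaptive.subdifferential X (fun y => F y z) x) →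
      ∀ A : (k : ℕ) → (Fin k → PrivateAdaptive.Vec d) → Matrix (Fin d) (Fin d) ℝ,
        (∀ k p q, Measurable fun h => A k h p q) →
        (∀ k h, (A k h).PosDef) →
      ∀ x₀ ∈ X, ∀ α : ℝ, 0 < α →
        PrivateAdaptive.IsDP (PrivateAdaptive.runLaw n b d T)
          (PrivateAdaptive.pasan X x₀ α ε δ g A T) ε δ ∧
        PrivateAdaptive.IsDP (PrivateAdaptive.runLaw n b d T)
          (PrivateAdaptive.pagan X x₀ α ε δ g A T) ε δ := by
  -- The two methods differ only in how the iterates are computed from the private gradients, so the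
  -- measurability of each update rule is all that has to be supplied separately.
  refine ⟨1 / 10, by norm_num, PrivateAdaptive.iterationConst, PrivateAdaptive.iterationConst_pos,
    ?_⟩
  intro n b d T hn hb hT ε δ hε hε1 hδ hεδ Z X hX hXc F _ g hg _ A hA hpos x₀ hx₀ α hα
  exact ⟨PrivateAdaptive.isDP_averageIterate hn hb hT hε hε1 hδ hεδ hg hA hpos
      (PrivateAdaptive.measurable_pasanIter hX hXc hx₀ α),
    PrivateAdaptive.isDP_averageIterate hn hb hT hε hε1 hδ hεδ hg hA hpos
      (PrivateAdaptive.measurable_paganIter hX hXc hx₀ hα)⟩
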